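/- Let $m$ be normalised Lebesgue measure on $\partial\mathbb{D}$. An analytic $g\colon\mathbb{D}\to\mathbb{D}$ is inner if for $m$-almost every $\zeta\in\partial\mathbb{D}$ the radial limit $\hat g(\zeta)=\lim_{r\nearrow 1}g(r\zeta)$ exists and has modulus one. Let $g_n\colon\mathbb{D}\to\mathbb{D}$, $n\ge 1$, be inner functions with $g_n(0)=0$, let $G_n=g_n\circ\cdots\circ g_1$, and let $\widehat G_n$ be the ($m$-a.e. defined) boundary map of $G_n$. A sequence $(T_n)_{n\ge1}$ of measure-preserving transformations of a probability space $(X,\mu)$ is called ergodic if $\bigl\|\frac1N\sum_{n=1}^N\varphi\circ T_n-\int_X\varphi\,d\mu\bigr\|_{L^2(\mu)}\to0$ as $N\to\infty$ for every $\varphi\in L^2(\mu)$, and mixing if every subsequence of it is ergodic. (On $\partial\mathbb{D}$ the measure is $\mu=m$; transformations are understood up to null sets, and that the maps $\widehat G_n$ preserve $m$ is part of the claims below.) (i) If $\sum_{n\ge1}(1-|g_n'(0)|)=\infty$, then $\{\widehat G_n\}$ has a mixing subsequence. (ii) If there are constants $0<\lambda<1$, $0<c<1$ and $M_0>0$ such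 that $\#\{n\in[a,b]: |g_n'(0)|\le\lambda\}\ge c(b-a)$ for all integers $a,b\ge1$ with $b-a>M_0$, then $\{\widehat G_n\}$ is mixing. (iii) (a) If $\sum_{n\ge1}(1-|g_n'(0)|)<\infty$ and $\arg g_n'(0)\to2\pi\theta$ modulo $2\pi$ as $n\to\infty$ for some irrational number $\theta$, then $\{\widehat G_n\}$ is ergodic. (b) Let the $g_n$ be random, that is, for each point of a probability space let $(g_n)_{n\ge1}$ be a sequence of inner functions fixing the origin, and assume that $\sum_{n\ge1}(1-|g_n'(0)|)<\infty$ almost surely. If $g_n'(0)=|g_n'(0)|\,\Theta_n$ almost surely for every $n$, where the $\Theta_n=e^{i\theta_n}$ are independent and identically distributed random variables with values in $\partial\mathbb{D}$ whose common law has no atoms, then $\{\widehat G_n\}$ is ergodic almost surely. -/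

import Mathlib

open MeasureTheory ProbabilityTheory Filter Topology

noncomputable instance instMeasurableSpaceCircle : MeasurableSpace Circle := borel Circle

instance instBorelSpaceCircle : BorelSpace Circle := ⟨rfl⟩

/-- Normalised Lebesgue measure `dθ / 2π` on the unit circle. -/
noncomputable def circleMeasure : Measure Circle :=
  Measure.map Circle.exp
    ((ENNReal.ofReal (2 * Real.pi))⁻¹ • volume.restrict (Set.Ioc 0 (2 * Real.pi)))

instance instIsProbabilityMeasureCircleMeasure : IsProbabilityMeasure circleMeasure := by
  have h : (0 : ℝ) < 2 * Real.pi := by positivity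
  refine ⟨?_⟩
  rw [circleMeasure, Measure.map_apply Circle.exp.continuous.measurable MeasurableSet.univ]
  simp only [Set.preimage_univ, Measure.smul_apply, Measure.restrict_apply MeasurableSet.univ,
    Set.univ_inter, Real.volume_Ioc, sub_zero, smul_eq_mul]
  exact ENNReal.inv_mul_cancel (by simpa using h) ENNReal.ofReal_ne_top

/-- `w` is the radial limit of `g` at the boundary point `ζ`. -/
def IsRadialLimit (g : ℂ → ℂ) (ζ w : Circle) : Prop :=
  Tendsto (fun r : ℝ => g ((r : ℂ) * (ζ : ℂ))) (𝓝[<] (1 : ℝ)) (𝓝 (w : ℂ))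

/-- Inner functions: analytic self-maps of the open unit disc having a radial limit of modulus one
at almost every boundary point. The values of `g` outside the open disc play no role. -/
structure IsInnerFunction (g : ℂ → ℂ) : Prop where
  differentiableOn : DifferentiableOn ℂ g (Metric.ball 0 1)
  mapsTo : Set.MapsTo g (Metric.ball 0 1) (Metric.ball 0 1)
  radial : ∀ᵐ ζ ∂circleMeasure, ∃ w : Circle, IsRadialLimit g ζ w

open Classical in
/-- The boundary map of `g`, given by radial limits. For an inner function it is defined almost
everywhere; at the remaining points it is assigned the value `1`. -/
noncomputable def boundaryMap (g : ℂ → ℂ) (ζ : Circle) : Circle :=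
  if h : ∃ w : Circle, IsRadialLimit g ζ w then h.choose else 1

/-- `compSeq g n = g n ∘ g (n - 1) ∘ ⋯ ∘ g 1`; the entry `g 0` is not used. -/
def compSeq (g : ℕ → ℂ → ℂ) : ℕ → ℂ → ℂ
  | 0 => id
  | n + 1 => g (n + 1) ∘ compSeq g n

/-- Ergodicity of a sequence `T 1, T 2, …` of measure-preserving transformations of `(X, μ)`, each
defined up to a null set: for every `φ` in `L²(μ)` the averages of `φ ∘ T n` converge in `L²(μ)`
to the mean of `φ`. -/
structure IsErgodicSeq {X : Type*} [MeasurableSpace X] (μ : Measure X) (T : ℕ → X → X) :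
    Prop where
  aemeasurable : ∀ n, 1 ≤ n → AEMeasurable (T n) μ
  map_eq : ∀ n, 1 ≤ n → Measure.map (T n) μ = μ
  tendsto_average : ∀ φ : X → ℂ, MemLp φ 2 μ →
    Tendsto (fun N : ℕ => eLpNorm
      (fun x => (N : ℂ)⁻¹ * ∑ n ∈ Finset.Icc 1 N, φ (T n x) - ∫ y, φ y ∂μ) 2 μ) atTop (𝓝 0)

/-- A sequence `T 1, T 2, …` is mixing if all its subsequences are ergodic. A strictly increasing
`s : ℕ → ℕ` satisfies `1 ≤ s 1`, so `s 1 < s 2 < ⋯` is a sequence of positive indices. -/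
def IsMixingSeq {X : Type*} [MeasurableSpace X] (μ : Measure X) (T : ℕ → X → X) : Prop :=
  ∀ s : ℕ → ℕ, StrictMono s → IsErgodicSeq μ (fun k => T (s k))

/-!
The boundary maps of `G n = g n ∘ ⋯ ∘ g 1` are studied through their correlations. If `m ≤ n`, then
`G n = h ∘ G m` with `h 0 = 0` and `h' 0 = ∏ j ∈ Ioc m n, (g j)' 0`. Writing `h w ^ k = w ^ k * Q w`
with `Q` bounded and `Q 0 = h' 0 ^ k`, and using that `|G m| → 1` along almost every radius, the
mean value property gives
`∫ Ĝ_n ^ k * conj (Ĝ_m ^ k) = ∏ j ∈ Ioc m n, ((g j)' 0) ^ k`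
(`integral_boundaryMap_compSeq`). As trigonometric polynomials are dense in `L²`, ergodicity means
that for each `k ≥ 1` the averages of the unit vectors `Ĝ_n ^ k` tend to `0` in `L²`
(`isErgodicSeq_of_tendsto_pow`), which is now a question about vectors with given inner products.

* If the inner products decay geometrically in `n - m`, the averages of every subsequence tend to
  `0` (`isMixingSeq_of_geometric`). This is the density hypothesis of (ii) directly, and holds along
  a subsequence when `∑ (1 - |(g n)' 0|)` diverges.
* If `(g n)' 0 → e`, with `e` of modulus one and `e ^ k ≠ 1`, then
  `‖Ĝ_{n+1} ^ k - e ^ k Ĝ_n ^ k‖² → 0`, so the averages `a` satisfy `(1 - e ^ k) a → 0`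
  (`isErgodicSeq_of_tendsto_arg`).
* If `∑ (1 - |(g n)' 0|)` converges and `(g n)' 0 = |(g n)' 0| Θ n`, then the vectors
  `conj (Θ 1 ⋯ Θ n) ^ k Ĝ_n ^ k` form a Cauchy sequence, so it is enough that the averages of
  `(Θ 1 ⋯ Θ n) ^ k` tend to `0` (`isErgodicSeq_of_tendsto_average_prod`). For independent
  identically distributed `Θ n` without atoms this holds almost surely, since the correlations are
  powers of `E Θ ^ k`, which has modulus less than one (`ae_tendsto_average_walk_pow`).

Two facts about the disc carry the rest. Fatou's theorem (`ae_exists_tendsto_radial`): a bounded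
analytic function has a Lipschitz primitive, whose boundary values are differentiable almost
everywhere, and Cauchy's formula after a disc automorphism turns differentiability at a boundary
point into a radial limit of the derivative. Compositions of inner functions are inner
(`IsInnerFunction.comp`): for inner `f` fixing `0` and bounded analytic `b`, the limit of
`∫ b (f (r ζ)) * (boundary value of f) ^ n` does not depend on `f`, and comparison with the identity
shows that `g ∘ f` has unimodular radial limits. The case `b = 1` says that boundary maps preserve
the measure (`IsInnerFunction.map_boundaryMap`).
-/

/-! ### Integration over the circle -/

theorem continuous_circle_coe : Continuous fun ζ : Circle => (ζ : ℂ) := by fun_prop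

theorem integral_circleMeasure_eq_circleAverage {f : ℂ → ℂ}
    (hf : ContinuousOn f (Metric.sphere 0 1)) :
    ∫ ζ : Circle, f ζ ∂circleMeasure = Real.circleAverage f 0 1 := by
  have hc : Continuous fun ζ : Circle => f ζ :=
    hf.comp_continuous continuous_circle_coe fun ζ => by simp [Circle.norm_coe]
  rw [circleMeasure, integral_map Circle.exp.continuous.measurable.aemeasurable
    hc.aestronglyMeasurable, integral_smul_measure, Real.circleAverage_def,
    intervalIntegral.integral_of_le (by positivity), ENNReal.toReal_inv,
    ENNReal.toReal_ofReal (by positivity)]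
  simp [circleMap, Circle.coe_exp]

theorem integral_circleMeasure_of_diffContOnCl {f : ℂ → ℂ}
    (hf : DiffContOnCl ℂ f (Metric.ball 0 1)) :
    ∫ ζ : Circle, f ζ ∂circleMeasure = f 0 := by
  rw [integral_circleMeasure_eq_circleAverage]
  · exact DiffContOnCl.circleAverage (by simpa using hf)
  · exact hf.continuousOn_ball.mono Metric.sphere_subset_closedBall

theorem integral_circleMeasure_mul_conj_of_diffContOnCl {f : ℂ → ℂ}
    (hf : DiffContOnCl ℂ f (Metric.ball 0 1)) :
    ∫ ζ : Circle, f ζ * (starRingEnd ℂ) (ζ : ℂ) ∂circleMeasure = deriv f 0 := by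
  have h1 : ∀ ζ : Circle, f ζ * (starRingEnd ℂ) (ζ : ℂ) = (fun z => z⁻¹ * f z) ζ := by
    intro ζ
    rw [← Circle.coe_inv_eq_conj, Circle.coe_inv, mul_comm]
  simp_rw [h1]
  rw [integral_circleMeasure_eq_circleAverage (f := fun z => z⁻¹ * f z),
    Real.circleAverage_eq_circleIntegral one_ne_zero]
  · have := hf.deriv_eq_smul_circleIntegral one_pos
    have h2 : (fun z : ℂ => (z - 0)⁻¹ • (z⁻¹ * f z)) = fun z => (1 / (z - 0) ^ 2) • f z := by
      ext z; simp; ring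
    rw [h2, this, smul_smul, inv_mul_cancel₀ Complex.two_pi_I_ne_zero, one_smul]
  · refine ContinuousOn.mul (continuousOn_inv₀.mono ?_)
      (hf.continuousOn_ball.mono Metric.sphere_subset_closedBall)
    intro z hz
    simpa using ne_zero_of_mem_unit_sphere (⟨z, hz⟩ : Metric.sphere (0 : ℂ) 1)

theorem ofReal_mul_coe_mem_ball {r : ℝ} (h0 : 0 ≤ r) (h1 : r < 1) (ζ : Circle) :
    (r : ℂ) * ζ ∈ Metric.ball (0 : ℂ) 1 := by
  simpa [abs_of_nonneg h0, Circle.norm_coe] using h1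

theorem continuous_comp_ofReal_mul {f : ℂ → ℂ} (hf : ContinuousOn f (Metric.ball 0 1)) {r : ℝ}
    (h0 : 0 ≤ r) (h1 : r < 1) : Continuous fun ζ : Circle => f ((r : ℂ) * ζ) :=
  hf.comp_continuous (by fun_prop) (ofReal_mul_coe_mem_ball h0 h1)

theorem integral_circleMeasure_ofReal_mul {f : ℂ → ℂ} (hf : DifferentiableOn ℂ f (Metric.ball 0 1))
    {r : ℝ} (h0 : 0 ≤ r) (h1 : r < 1) :
    ∫ ζ : Circle, f ((r : ℂ) * ζ) ∂circleMeasure = f 0 := by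
  have h := integral_circleMeasure_of_diffContOnCl (f := fun z => f (r * z)) ?_
  · simpa using h
  · have hm : Set.MapsTo (fun z : ℂ => (r : ℂ) * z) (Metric.closedBall 0 1) (Metric.ball 0 1) := by
      intro z hz
      simp only [mem_closedBall_zero_iff, mem_ball_zero_iff, norm_mul, Complex.norm_real,
        Real.norm_eq_abs, abs_of_nonneg h0] at hz ⊢
      nlinarith [norm_nonneg z]
    refine (DifferentiableOn.mono ?_ (closure_ball (0 : ℂ) one_ne_zero).subset).diffContOnCl
    exact hf.comp (by fun_prop) hm

theorem eventually_mem_Ioo_nhdsLT_one : ∀ᶠ r : ℝ in 𝓝[<] 1, 0 < r ∧ r < 1 :=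
  Ioo_mem_nhdsLT one_pos

/-- A property of boundary points may be checked almost everywhere in the angular coordinate. -/
theorem ae_circleMeasure_of_ae_exp {p : Circle → Prop}
    (hm : MeasurableSet {θ : ℝ | p (Circle.exp θ)}) (h : ∀ᵐ θ : ℝ, p (Circle.exp θ)) :
    ∀ᵐ ζ ∂circleMeasure, p ζ := by
  have hm' : MeasurableSet {ζ : Circle | p ζ} := by
    have : {ζ : Circle | p ζ} =
        (fun ζ : Circle => Complex.arg (ζ : ℂ)) ⁻¹' {θ : ℝ | p (Circle.exp θ)} := by
      ext ζ; simp
    rw [this]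
    exact (Complex.measurable_arg.comp continuous_circle_coe.measurable) hm
  rw [circleMeasure, ae_map_iff Circle.exp.continuous.measurable.aemeasurable hm']
  exact Measure.ae_smul_measure (ae_restrict_of_ae h) _

/-! ### Radial limits of bounded analytic functions -/

/-- The disc automorphism `w ↦ (w + r) / (1 + r w)` carrying `0` to `r` and fixing `1`. -/
noncomputable def discShift (r : ℝ) (w : ℂ) : ℂ := (w + r) / (1 + r * w)

section discShift
variable {r : ℝ} {w : ℂ}

theorem one_sub_le_norm_one_add_mul (h0 : 0 ≤ r) (hw : ‖w‖ ≤ 1) :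
    1 - r ≤ ‖1 + r * w‖ := by
  have h := norm_sub_norm_le (1 : ℂ) (-(r * w))
  rw [sub_neg_eq_add, norm_neg, norm_mul, norm_one, Complex.norm_real, Real.norm_eq_abs,
    abs_of_nonneg h0] at h
  nlinarith

theorem one_add_mul_ne_zero (h0 : 0 ≤ r) (h1 : r < 1) (hw : ‖w‖ ≤ 1) : 1 + r * w ≠ 0 := by
  have := one_sub_le_norm_one_add_mul h0 hw
  rw [← norm_pos_iff]; linarith

theorem norm_sq_one_add_mul_sub (r : ℝ) (w : ℂ) :
    ‖1 + r * w‖ ^ 2 - ‖w + r‖ ^ 2 = (1 - r ^ 2) * (1 - ‖w‖ ^ 2) := by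
  simp only [← Complex.normSq_eq_norm_sq, Complex.normSq_apply]
  simp
  ring

theorem norm_discShift_lt_one (h0 : 0 ≤ r) (h1 : r < 1) (hw : ‖w‖ < 1) : ‖discShift r w‖ < 1 := by
  have h := norm_sq_one_add_mul_sub r w
  rw [discShift, norm_div, div_lt_one (norm_pos_iff.2 (one_add_mul_ne_zero h0 h1 hw.le))]
  refine lt_of_pow_lt_pow_left₀ 2 (norm_nonneg _) ?_
  have : 0 < (1 - r ^ 2) * (1 - ‖w‖ ^ 2) := mul_pos (by nlinarith) (by nlinarith [norm_nonneg w])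
  linarith

theorem norm_discShift_eq_one (h0 : 0 ≤ r) (h1 : r < 1) (hw : ‖w‖ = 1) : ‖discShift r w‖ = 1 := by
  have h := norm_sq_one_add_mul_sub r w
  rw [discShift, norm_div, div_eq_one_iff_eq (norm_ne_zero_iff.2 (one_add_mul_ne_zero h0 h1 hw.le))]
  rw [hw] at h
  exact (sq_eq_sq₀ (norm_nonneg _) (norm_nonneg _)).1 (by linarith)

theorem discShift_sub_one (h0 : 0 ≤ r) (h1 : r < 1) (hw : ‖w‖ ≤ 1) :
    discShift r w - 1 = (1 - r) * ((w - 1) / (1 + r * w)) := by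
  have := one_add_mul_ne_zero h0 h1 hw
  rw [discShift, ← mul_div_assoc, div_sub_one this]
  congr 1; ring

theorem norm_one_add_le_two_mul (h0 : 0 ≤ r) (h1 : r < 1) (hw : ‖w‖ ≤ 1) :
    ‖1 + w‖ ≤ 2 * ‖1 + r * w‖ := by
  have h2 := one_sub_le_norm_one_add_mul h0 hw
  have h : ‖1 + w‖ ≤ ‖1 + r * w‖ + ‖((1 - r : ℝ) : ℂ) * w‖ := by
    refine le_trans (le_of_eq ?_) (norm_add_le _ _)
    congr 1; push_cast; ring
  rw [norm_mul, Complex.norm_real, Real.norm_eq_abs, abs_of_nonneg (by linarith)] at h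
  nlinarith [norm_nonneg w]

theorem hasDerivAt_discShift_zero (r : ℝ) : HasDerivAt (discShift r) (1 - r ^ 2 : ℂ) 0 := by
  have h := ((hasDerivAt_id (0 : ℂ)).add_const (r : ℂ)).div
    (((hasDerivAt_id (0 : ℂ)).const_mul (r : ℂ)).const_add 1) (by simp)
  convert! h using 1
  simp; ring

theorem diffContOnCl_comp_discShift {f : ℂ → ℂ} (hf : DiffContOnCl ℂ f (Metric.ball 0 1))
    (h0 : 0 ≤ r) (h1 : r < 1) : DiffContOnCl ℂ (fun w => f (discShift r w)) (Metric.ball 0 1) := by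
  have hd : DifferentiableOn ℂ (discShift r) (Metric.closedBall 0 1) := by
    refine DifferentiableOn.div (by fun_prop) (by fun_prop) fun w hw => ?_
    exact one_add_mul_ne_zero h0 h1 (by simpa using hw)
  refine hf.comp (DifferentiableOn.diffContOnCl ?_) ?_
  · rwa [closure_ball (0 : ℂ) one_ne_zero]
  · intro w hw
    simpa using norm_discShift_lt_one h0 h1 (by simpa using hw)

end discShift

/-- If `K` is small of higher order than the arc length at the boundary point `1`, then `K'` tends
to `0` along the radius ending there. The conformal change of variables `discShift r` turns Cauchy's
formula for `K'(r)` into an integral over a fixed circle; subtracting `w` from the kernel `conj w`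
costs nothing, and makes it vanish at `-1`, which is what dominates the integrand. -/
theorem tendsto_deriv_of_isLittleO {K : ℂ → ℂ} (hK : DiffContOnCl ℂ K (Metric.ball 0 1)) {C : ℝ}
    (hC : ∀ z : ℂ, ‖K z‖ ≤ C * ‖z - 1‖)
    (ho : (fun t : ℝ => K (Complex.exp (t * Complex.I))) =o[𝓝 0] fun t : ℝ => t) :
    Tendsto (fun r : ℝ => deriv K r) (𝓝[<] 1) (𝓝 0) := by
  have hC0 : 0 ≤ C := by
    have := (norm_nonneg _).trans (hC 0); simpa using this
  set F : ℝ → Circle → ℂ := fun r w =>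
    (1 - r : ℂ)⁻¹ * (K (discShift r w) * ((starRingEnd ℂ) (w : ℂ) - w)) with hF
  -- Cauchy's formula at the centre, together with the vanishing of `∫ K (discShift r w) * w`
  have hformula : ∀ r : ℝ, 0 < r → r < 1 → ∫ w, F r w ∂circleMeasure = (1 + r) * deriv K r := by
    intro r h0 h1
    have hd := diffContOnCl_comp_discShift hK h0.le h1
    have hcK : Continuous fun w : Circle => K (discShift r w) :=
      hd.continuousOn_ball.comp_continuous continuous_circle_coe fun ζ => by simp [Circle.norm_coe]
    have e1 := integral_circleMeasure_mul_conj_of_diffContOnCl hd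
    have e2 := integral_circleMeasure_of_diffContOnCl
      (hd.smul (differentiable_id.diffContOnCl (s := Metric.ball (0 : ℂ) 1)))
    have hder : deriv (fun w => K (discShift r w)) 0 = deriv K r * (1 - r ^ 2) := by
      have hz : discShift r 0 = r := by simp [discShift]
      have hKd : DifferentiableAt ℂ K (discShift r 0) := by
        rw [hz]
        exact hK.differentiableAt Metric.isOpen_ball (by simpa [abs_of_pos h0] using h1)
      have := (hKd.hasDerivAt.comp 0 (hasDerivAt_discShift_zero r)).deriv
      rw [hz] at this
      exact this
    simp only [hF, mul_sub]
    have hi : ∀ f : Circle → ℂ, Continuous f → Integrable f circleMeasure := fun f hf =>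
      hf.integrable_of_hasCompactSupport (HasCompactSupport.of_compactSpace f)
    have c1 : Continuous fun w : Circle =>
        (1 - r : ℂ)⁻¹ * (K (discShift r w) * (starRingEnd ℂ) (w : ℂ)) :=
      continuous_const.mul (hcK.mul (Complex.continuous_conj.comp continuous_circle_coe))
    have c2 : Continuous fun w : Circle => (1 - r : ℂ)⁻¹ * (K (discShift r w) * (w : ℂ)) :=
      continuous_const.mul (hcK.mul continuous_circle_coe)
    rw [integral_sub (hi _ c1) (hi _ c2), integral_const_mul,
      integral_const_mul, e1, hder]
    simp only [id, smul_eq_mul] at e2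
    rw [e2]
    have : (1 - r : ℂ) ≠ 0 := by
      rw [sub_ne_zero]; exact_mod_cast h1.ne'
    field_simp
    ring
  have hlim : Tendsto (fun r => ∫ w, F r w ∂circleMeasure) (𝓝[<] 1)
      (𝓝 (∫ _, (0 : ℂ) ∂circleMeasure)) := by
    refine tendsto_integral_filter_of_dominated_convergence (fun _ => 8 * C) ?_ ?_
      (integrable_const _) ?_
    · filter_upwards [eventually_mem_Ioo_nhdsLT_one] with r ⟨h0, h1⟩
      have hcK : Continuous fun w : Circle => K (discShift r w) :=
        (diffContOnCl_comp_discShift hK h0.le h1).continuousOn_ball.comp_continuous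
          continuous_circle_coe fun ζ => by simp [Circle.norm_coe]
      exact Continuous.aestronglyMeasurable (continuous_const.mul
        (hcK.mul ((Complex.continuous_conj.comp continuous_circle_coe).sub continuous_circle_coe)))
    · filter_upwards [eventually_mem_Ioo_nhdsLT_one] with r ⟨h0, h1⟩
      refine Eventually.of_forall fun w => ?_
      have hw : ‖(w : ℂ)‖ ≤ 1 := (Circle.norm_coe w).le
      have hk : ‖(starRingEnd ℂ) (w : ℂ) - w‖ = ‖(w : ℂ) - 1‖ * ‖1 + (w : ℂ)‖ := by
        have h := congrArg norm (by ring : (w : ℂ) * ((starRingEnd ℂ) (w : ℂ) - w) =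
          w * (starRingEnd ℂ) (w : ℂ) - w ^ 2)
        rw [norm_mul, Circle.norm_coe, one_mul, Complex.mul_conj, Circle.normSq_coe] at h
        rw [h, ← norm_mul, norm_sub_rev]
        congr 1; push_cast; ring
      have hpos : 0 < ‖1 + (r : ℂ) * w‖ := norm_pos_iff.2 (one_add_mul_ne_zero h0.le h1 hw)
      have hr : ‖(1 - r : ℂ)‖ = 1 - r := by
        rw [← Complex.ofReal_one, ← Complex.ofReal_sub, Complex.norm_real, Real.norm_eq_abs,
          abs_of_pos (by linarith)]
      have h2 : ‖(w : ℂ) - 1‖ ≤ 2 := (norm_sub_le _ _).trans (by norm_num [Circle.norm_coe])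
      have h3 := norm_one_add_le_two_mul h0.le h1 hw
      have h4 := hC (discShift r w)
      rw [discShift_sub_one h0.le h1 hw, norm_mul, hr, norm_div] at h4
      simp only [hF]
      rw [norm_mul, norm_mul, norm_inv, hr, hk]
      have hr' : (0 : ℝ) < 1 - r := by linarith
      calc (1 - r)⁻¹ * (‖K (discShift r w)‖ * (‖(w : ℂ) - 1‖ * ‖1 + (w : ℂ)‖))
          ≤ (1 - r)⁻¹ * (C * ((1 - r) * (‖(w : ℂ) - 1‖ / ‖1 + (r : ℂ) * w‖)) *
              (2 * (2 * ‖1 + (r : ℂ) * w‖))) := by gcongr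
        _ = 4 * C * ‖(w : ℂ) - 1‖ := by
          generalize ‖1 + (r : ℂ) * w‖ = d at hpos
          field_simp; ring
        _ ≤ 8 * C := by nlinarith [mul_le_mul_of_nonneg_left h2 hC0]
    · have hae : ∀ᵐ w : Circle ∂circleMeasure, 1 + (w : ℂ) ≠ 0 := by
        refine ae_circleMeasure_of_ae_exp ?_ ?_
        · have hcl : IsClosed {θ : ℝ | 1 + ((Circle.exp θ : Circle) : ℂ) = 0} :=
            isClosed_eq (by fun_prop) continuous_const
          exact hcl.isOpen_compl.measurableSet
        · have hs : {θ : ℝ | 1 + ((Circle.exp θ : Circle) : ℂ) = 0} ⊆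
              Set.range fun n : ℤ => Real.pi + n * (2 * Real.pi) := by
            intro θ hθ
            have : Complex.exp (θ * Complex.I) = Complex.exp (Real.pi * Complex.I) := by
              rw [Complex.exp_pi_mul_I, ← Circle.coe_exp]
              exact (eq_neg_of_add_eq_zero_right hθ)
            obtain ⟨n, hn⟩ := Complex.exp_eq_exp_iff_exists_int.1 this
            refine ⟨n, ?_⟩
            have hI : (θ : ℂ) * Complex.I = (Real.pi + n * (2 * Real.pi)) * Complex.I := by
              rw [hn]; ring
            exact_mod_cast (mul_right_cancel₀ Complex.I_ne_zero hI).symm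
          exact measure_mono_null (fun θ hθ => hs (not_not.1 hθ))
            ((Set.countable_range _).measure_zero volume)
      filter_upwards [hae] with w hw
      have hw1 : ‖(w : ℂ)‖ ≤ 1 := (Circle.norm_coe w).le
      have hpos : 0 < ‖1 + (w : ℂ)‖ := norm_pos_iff.2 hw
      -- the angle of `discShift r w` is `O(1 - r)`, so `K (discShift r w)` is `o(1 - r)`
      have hbd : ∀ᶠ r : ℝ in 𝓝[<] 1, |Complex.arg (discShift r w)| ≤
          Real.pi / 2 * (4 / ‖1 + (w : ℂ)‖) * |1 - r| := by
        filter_upwards [eventually_mem_Ioo_nhdsLT_one] with r ⟨h0, h1⟩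
        have hn := norm_discShift_eq_one h0.le h1 (Circle.norm_coe w)
        have ha := Complex.angle_le_mul_norm_sub hn norm_one
        rw [Complex.angle_one_right (by rw [← norm_ne_zero_iff, hn]; norm_num),
          discShift_sub_one h0.le h1 hw1, norm_mul, norm_div] at ha
        have hr : ‖(1 - r : ℂ)‖ = |1 - r| := by
          rw [← Complex.ofReal_one, ← Complex.ofReal_sub, Complex.norm_real, Real.norm_eq_abs]
        rw [hr] at ha
        have hpos' : 0 < ‖1 + (r : ℂ) * w‖ := norm_pos_iff.2 (one_add_mul_ne_zero h0.le h1 hw1)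
        have h2 : ‖(w : ℂ) - 1‖ ≤ 2 := (norm_sub_le _ _).trans (by norm_num [Circle.norm_coe])
        have h3 := norm_one_add_le_two_mul h0.le h1 hw1
        refine ha.trans ?_
        rw [mul_assoc, mul_comm |1 - r|]
        refine mul_le_mul_of_nonneg_left (mul_le_mul_of_nonneg_right ?_ (abs_nonneg _))
          (by positivity)
        rw [div_le_div_iff₀ hpos' hpos]
        nlinarith [norm_nonneg ((w : ℂ) - 1)]
      have hO : (fun r : ℝ => Complex.arg (discShift r w)) =O[𝓝[<] 1] fun r => 1 - r :=
        Asymptotics.IsBigO.of_bound _ (by simpa only [Real.norm_eq_abs] using hbd)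
      have hr0 : Tendsto (fun r : ℝ => 1 - r) (𝓝[<] 1) (𝓝 0) := by
        have : Tendsto (fun r : ℝ => 1 - r) (𝓝 1) (𝓝 (1 - 1)) :=
          (continuous_const.sub continuous_id).tendsto 1
        rw [sub_self] at this
        exact this.mono_left nhdsWithin_le_nhds
      have ho' := (ho.comp_tendsto (hO.trans_tendsto hr0)).trans_isBigO hO
      have ht := ho'.tendsto_inv_smul_nhds_zero
      have ht2 := ht.mul_const ((starRingEnd ℂ) (w : ℂ) - w)
      rw [zero_mul] at ht2
      refine ht2.congr' ?_
      filter_upwards [eventually_mem_Ioo_nhdsLT_one] with r ⟨h0, h1⟩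
      have hn := norm_discShift_eq_one h0.le h1 (Circle.norm_coe w)
      have hexp : Complex.exp (Complex.arg (discShift r w) * Complex.I) = discShift r w := by
        have := Complex.norm_mul_exp_arg_mul_I (discShift r w)
        rwa [hn, Complex.ofReal_one, one_mul] at this
      simp only [Function.comp, hF, hexp, Complex.real_smul]
      push_cast; ring
  rw [integral_zero] at hlim
  have h1r : Tendsto (fun r : ℝ => ((1 : ℂ) + r)⁻¹) (𝓝[<] 1) (𝓝 ((1 + (1 : ℝ) : ℂ)⁻¹)) := by
    refine Tendsto.mono_left ?_ nhdsWithin_le_nhds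
    refine Tendsto.inv₀ (tendsto_const_nhds.add (Complex.continuous_ofReal.tendsto 1)) ?_
    norm_num
  have := h1r.mul hlim
  rw [mul_zero] at this
  refine this.congr' ?_
  filter_upwards [eventually_mem_Ioo_nhdsLT_one] with r ⟨h0, h1⟩
  rw [hformula r h0 h1, ← mul_assoc, inv_mul_cancel₀, one_mul]
  exact_mod_cast (by linarith : (1 + r) ≠ 0)

/-- Angular differentiability of the boundary values of a primitive at `ζ` forces a radial limit of
the derivative at `ζ`. -/
theorem exists_tendsto_deriv_of_differentiableAt {H : ℂ → ℂ} {L : NNReal} (hL : LipschitzWith L H)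
    (hH : DifferentiableOn ℂ H (Metric.ball 0 1)) (ζ : Circle)
    (hd : DifferentiableAt ℝ (fun t : ℝ => H (ζ * Complex.exp (t * Complex.I))) 0) :
    ∃ w : ℂ, Tendsto (fun r : ℝ => deriv H (r * ζ)) (𝓝[<] 1) (𝓝 w) := by
  obtain ⟨D, hD⟩ : ∃ D, HasDerivAt (fun t : ℝ => H (ζ * Complex.exp (t * Complex.I))) D 0 :=
    ⟨_, hd.hasDerivAt⟩
  -- `A` is the derivative of `z ↦ H (ζ z)` along the circle at `1`; it is the radial limit of that
  -- function's derivative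
  set A : ℂ := D * (-Complex.I) with hA
  have hζ : ‖(ζ : ℂ)‖ = 1 := Circle.norm_coe ζ
  set K : ℂ → ℂ := fun z => H (ζ * z) - H ζ - A * (z - 1) with hKdef
  have hmaps : Set.MapsTo (fun z : ℂ => (ζ : ℂ) * z) (Metric.ball 0 1) (Metric.ball 0 1) := by
    intro z hz
    simpa [hζ] using hz
  have hKd : DifferentiableOn ℂ K (Metric.ball 0 1) :=
    ((hH.comp (by fun_prop) hmaps).sub_const _).sub (by fun_prop)
  have hKc : Continuous K := ((hL.continuous.comp (by fun_prop)).sub continuous_const).sub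
    (by fun_prop)
  have hKb : ∀ z, ‖K z‖ ≤ (L + ‖A‖) * ‖z - 1‖ := by
    intro z
    have h1 : ‖H (ζ * z) - H ζ‖ ≤ L * ‖z - 1‖ := by
      have := hL.dist_le_mul (ζ * z) ζ
      rw [dist_eq_norm, dist_eq_norm] at this
      have h2 : (ζ : ℂ) * z - ζ = ζ * (z - 1) := by ring
      rwa [h2, norm_mul, hζ, one_mul] at this
    calc ‖K z‖ ≤ ‖H (ζ * z) - H ζ‖ + ‖A * (z - 1)‖ := norm_sub_le _ _
      _ ≤ L * ‖z - 1‖ + ‖A‖ * ‖z - 1‖ := by rw [norm_mul]; gcongr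
      _ = _ := by ring
  have hKo : (fun t : ℝ => K (Complex.exp (t * Complex.I))) =o[𝓝 0] fun t : ℝ => t := by
    have he : HasDerivAt (fun t : ℝ => Complex.exp (t * Complex.I)) Complex.I 0 := by
      have h1 : HasDerivAt (fun t : ℝ => (t : ℂ) * Complex.I) (1 * Complex.I) 0 :=
        (Complex.ofRealCLM.hasDerivAt (x := (0 : ℝ))).mul_const Complex.I
      simpa using h1.cexp
    have hK : HasDerivAt (fun t : ℝ => K (Complex.exp (t * Complex.I))) 0 0 := by
      have h := (hD.sub_const (H ζ)).sub ((he.sub_const 1).const_mul A)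
      have hz : D - A * Complex.I = 0 := by
        rw [hA, mul_assoc, neg_mul, Complex.I_mul_I]; ring
      rw [hz] at h
      exact h
    have h0 : K 1 = 0 := by simp [hKdef]
    have := hK.isLittleO
    simpa [h0] using this
  have hlim := tendsto_deriv_of_isLittleO ⟨hKd, hKc.continuousOn⟩ hKb hKo
  refine ⟨((ζ : ℂ)⁻¹) * (0 + A), ?_⟩
  refine ((hlim.add_const A).const_mul _).congr' ?_
  filter_upwards [eventually_mem_Ioo_nhdsLT_one] with r ⟨h0, h1⟩
  have hmem := ofReal_mul_coe_mem_ball h0.le h1 ζ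
  have hHd : HasDerivAt H (deriv H (r * ζ)) (ζ * r) := by
    rw [mul_comm (ζ : ℂ)]
    exact (hH.differentiableAt (Metric.isOpen_ball.mem_nhds hmem)).hasDerivAt
  have h2 : HasDerivAt (fun z : ℂ => (ζ : ℂ) * z) ζ (r : ℂ) := by
    simpa using (hasDerivAt_id (r : ℂ)).const_mul (ζ : ℂ)
  have h3 : HasDerivAt K (deriv H (r * ζ) * ζ - A) r := by
    have := ((hHd.comp (r : ℂ) h2).sub_const (H ζ)).sub
      (((hasDerivAt_id (r : ℂ)).sub_const 1).const_mul A)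
    simp only [mul_one] at this
    exact this
  rw [h3.deriv, sub_add_cancel, mul_comm, mul_assoc, mul_inv_cancel₀ (Circle.coe_ne_zero ζ),
    mul_one]

/-- **Fatou's theorem** for the disc: a bounded analytic function has radial limits almost
everywhere. A primitive of the function is Lipschitz, so its boundary values are differentiable
almost everywhere. -/
theorem ae_exists_tendsto_radial {h : ℂ → ℂ} (hd : DifferentiableOn ℂ h (Metric.ball 0 1))
    (hb : ∀ z ∈ Metric.ball (0 : ℂ) 1, ‖h z‖ ≤ 1) :
    ∀ᵐ ζ : Circle ∂circleMeasure,
      ∃ w : ℂ, Tendsto (fun r : ℝ => h (r * ζ)) (𝓝[<] 1) (𝓝 w) := by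
  obtain ⟨H₀, hH₀⟩ := hd.isExactOn_ball
  have hLip : LipschitzOnWith 1 H₀ (Metric.ball 0 1) :=
    (convex_ball (0 : ℂ) 1).lipschitzOnWith_of_nnnorm_hasDerivWithin_le
      (fun z hz => (hH₀ z hz).hasDerivWithinAt) fun z hz => by
        rw [← NNReal.coe_le_coe, coe_nnnorm]; exact hb z hz
  obtain ⟨H, hHL, hEq⟩ := hLip.extend_finite_dimension
  have hH : ∀ z ∈ Metric.ball (0 : ℂ) 1, HasDerivAt H (h z) z := fun z hz =>
    (hH₀ z hz).congr_of_eventuallyEq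
      ((hEq.symm.eventuallyEq_of_mem (Metric.isOpen_ball.mem_nhds hz)))
  have hHd : DifferentiableOn ℂ H (Metric.ball 0 1) := fun z hz =>
    (hH z hz).differentiableAt.differentiableWithinAt
  set u : ℝ → ℂ := fun θ => H (Circle.exp θ) with hu
  have huL : LipschitzWith (lipschitzExtensionConstant ℂ * 1) u := by
    have he : LipschitzWith 1 fun θ : ℝ => ((Circle.exp θ : Circle) : ℂ) := by
      refine LipschitzWith.of_dist_le_mul fun x y => ?_
      rw [NNReal.coe_one, one_mul, dist_eq_norm, dist_eq_norm, Circle.coe_exp, Circle.coe_exp]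
      have h1 : Complex.exp (x * Complex.I) - Complex.exp (y * Complex.I) =
          Complex.exp (y * Complex.I) * (Complex.exp (Complex.I * ((x - y : ℝ) : ℂ)) - 1) := by
        rw [mul_sub, ← Complex.exp_add]; push_cast; ring_nf
      rw [h1, norm_mul, Complex.norm_exp_ofReal_mul_I, one_mul]
      exact Real.norm_exp_I_mul_ofReal_sub_one_le
    rw [← mul_one (lipschitzExtensionConstant ℂ * 1)]
    exact hHL.comp he
  have hkey : ∀ θ : ℝ, DifferentiableAt ℝ
      (fun t : ℝ => H ((Circle.exp θ : Circle) * Complex.exp (t * Complex.I))) 0 ↔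
      DifferentiableAt ℝ u θ := by
    intro θ
    have hfun : (fun t : ℝ => H ((Circle.exp θ : Circle) * Complex.exp (t * Complex.I))) =
        fun t => u (t + θ) := by
      ext t
      rw [hu]
      simp only [Circle.coe_exp, ← Complex.exp_add]
      congr 2; push_cast; ring
    rw [hfun, differentiableAt_comp_add_const, zero_add]
  have hae : ∀ᵐ ζ : Circle ∂circleMeasure,
      DifferentiableAt ℝ (fun t : ℝ => H (ζ * Complex.exp (t * Complex.I))) 0 := by
    refine ae_circleMeasure_of_ae_exp ?_ ?_
    · simp only [hkey]
      exact measurableSet_of_differentiableAt ℝ u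
    · simp only [hkey]
      exact huL.ae_differentiableAt
  filter_upwards [hae] with ζ hζ
  obtain ⟨w, hw⟩ := exists_tendsto_deriv_of_differentiableAt hHL hHd ζ hζ
  refine ⟨w, hw.congr' ?_⟩
  filter_upwards [eventually_mem_Ioo_nhdsLT_one] with r ⟨h0, h1⟩
  exact (hH _ (ofReal_mul_coe_mem_ball h0.le h1 ζ)).deriv

/-! ### Trigonometric polynomials on the circle -/

/-- The monomial `ζ ↦ ζ ^ n`, for an integer `n`, as a continuous function on the circle. -/
noncomputable def circleZPow (n : ℤ) : C(Circle, ℂ) where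
  toFun ζ := ((ζ ^ n : Circle) : ℂ)
  continuous_toFun := continuous_circle_coe.comp (continuous_zpow n)

theorem circleZPow_apply (n : ℤ) (ζ : Circle) : circleZPow n ζ = (ζ : ℂ) ^ n := rfl

/-- Trigonometric polynomials are uniformly dense. -/
theorem dense_span_circleZPow :
    Dense (Submodule.span ℂ (Set.range circleZPow) : Set C(Circle, ℂ)) := by
  have : Fact (0 < 2 * Real.pi) := ⟨Real.two_pi_pos⟩
  let e : C(Circle, AddCircle (2 * Real.pi)) := ⟨AddCircle.homeomorphCircle'.symm, by fun_prop⟩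
  have hz : ∀ n : ℤ, (fourier n).comp e = circleZPow n := by
    intro n
    ext ζ
    obtain ⟨x, rfl⟩ := AddCircle.homeomorphCircle'.surjective ζ
    obtain ⟨t, rfl⟩ := QuotientAddGroup.mk_surjective x
    have h1 : e (AddCircle.homeomorphCircle' (t : AddCircle (2 * Real.pi))) =
        (t : AddCircle (2 * Real.pi)) := AddCircle.homeomorphCircle'.symm_apply_apply _
    change fourier n (e (AddCircle.homeomorphCircle' (t : AddCircle (2 * Real.pi)))) = _
    rw [h1, fourier_apply, AddCircle.toCircle_zsmul, AddCircle.toCircle_apply_mk,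
      div_self Real.two_pi_pos.ne', one_mul]
    rfl
  let φ := (ContinuousMap.compRightAlgHom ℂ ℂ e).toLinearMap
  have hφ : Submodule.map φ (Submodule.span ℂ (Set.range fourier)) =
      Submodule.span ℂ (Set.range circleZPow) := by
    rw [Submodule.map_span, ← Set.range_comp]
    congr 2
    ext1 n
    exact hz n
  have hd : Dense (Submodule.span ℂ (Set.range (fourier (T := 2 * Real.pi))) :
      Set C(AddCircle (2 * Real.pi), ℂ)) :=
    Submodule.dense_iff_topologicalClosure_eq_top.2 span_fourier_closure_eq_top
  rw [← hφ, Submodule.map_coe]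
  refine DenseRange.dense_image (f := φ) (Function.Surjective.denseRange fun f => ?_)
    (ContinuousMap.continuous_precomp e) hd
  refine ⟨f.comp ⟨AddCircle.homeomorphCircle', by fun_prop⟩, ?_⟩
  ext ζ
  exact congrArg f (AddCircle.homeomorphCircle'.apply_symm_apply ζ)

/-- The functional `f ↦ ∫ u · (f ∘ T) dμ` on continuous functions, for a bounded weight `u`. -/
noncomputable def circlePairing {X : Type*} [MeasurableSpace X] (μ : Measure X) [IsFiniteMeasure μ]
    (u : X → ℂ) (T : X → Circle) (hu : AEStronglyMeasurable u μ) (hu1 : ∀ᵐ x ∂μ, ‖u x‖ ≤ 1)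
    (hT : AEMeasurable T μ) : C(Circle, ℂ) →L[ℂ] ℂ :=
  have hb : ∀ f : C(Circle, ℂ), ∀ᵐ x ∂μ, ‖u x * f (T x)‖ ≤ ‖f‖ := fun f => by
    filter_upwards [hu1] with x hx
    rw [norm_mul]
    exact (mul_le_mul hx (f.norm_coe_le_norm _) (norm_nonneg _) zero_le_one).trans_eq (one_mul _)
  have hi : ∀ f : C(Circle, ℂ), Integrable (fun x => u x * f (T x)) μ := fun f =>
    Integrable.of_bound (hu.mul (f.continuous.measurable.comp_aemeasurable hT).aestronglyMeasurable)
      _ (hb f)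
  LinearMap.mkContinuous
    { toFun := fun f => ∫ x, u x * f (T x) ∂μ
      map_add' := fun f g => by
        rw [← integral_add (hi f) (hi g)]
        simp [mul_add]
      map_smul' := fun c f => by
        simp only [RingHom.id_apply, ← integral_smul]
        congr 1; ext x; simp; ring }
    (μ.real Set.univ) fun f => by
      exact (norm_integral_le_of_norm_le_const (hb f)).trans_eq (mul_comm _ _)

/-- Weighted integrals of continuous functions are determined by their Fourier coefficients. -/
theorem integral_mul_comp_eq_of_zpow {X Y : Type*} [MeasurableSpace X] [MeasurableSpace Y]
    {μ : Measure X} [IsFiniteMeasure μ] {ν : Measure Y} [IsFiniteMeasure ν]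
    {u : X → ℂ} {T : X → Circle} (hu : AEStronglyMeasurable u μ) (hu1 : ∀ᵐ x ∂μ, ‖u x‖ ≤ 1)
    (hT : AEMeasurable T μ)
    {v : Y → ℂ} {S : Y → Circle} (hv : AEStronglyMeasurable v ν) (hv1 : ∀ᵐ y ∂ν, ‖v y‖ ≤ 1)
    (hS : AEMeasurable S ν)
    (h : ∀ n : ℤ, ∫ x, u x * (T x : ℂ) ^ n ∂μ = ∫ y, v y * (S y : ℂ) ^ n ∂ν) (f : C(Circle, ℂ)) :
    ∫ x, u x * f (T x) ∂μ = ∫ y, v y * f (S y) ∂ν := by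
  have := ContinuousLinearMap.ext_on (f := circlePairing μ u T hu hu1 hT)
    (g := circlePairing ν v S hv hv1 hS) dense_span_circleZPow (by
      rintro _ ⟨n, rfl⟩
      exact h n)
  exact DFunLike.congr_fun this f

theorem map_eq_of_integral_zpow {X : Type*} [MeasurableSpace X]
    {μ : Measure X} [IsProbabilityMeasure μ] {ν : Measure Circle} [IsProbabilityMeasure ν]
    {T : X → Circle} (hT : AEMeasurable T μ)
    (h : ∀ n : ℤ, ∫ x, (T x : ℂ) ^ n ∂μ = ∫ y : Circle, (y : ℂ) ^ n ∂ν) : μ.map T = ν := by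
  have := Measure.isProbabilityMeasure_map (μ := μ) hT
  refine ext_of_forall_integral_eq_of_IsFiniteMeasure fun f => ?_
  have := integral_mul_comp_eq_of_zpow (μ := μ) (ν := ν) (u := fun _ => 1) (v := fun _ => 1)
    (T := T) (S := id) aestronglyMeasurable_const (by simp) hT
    aestronglyMeasurable_const (by simp) aemeasurable_id (by simpa using h)
    ⟨fun x => (f x : ℂ), by fun_prop⟩
  simp only [one_mul, ContinuousMap.coe_mk, id] at this
  rw [integral_complex_ofReal, integral_complex_ofReal] at this
  rw [integral_map hT f.continuous.aestronglyMeasurable]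
  exact_mod_cast this

/-- Trigonometric polynomials are dense in `L^p`. -/
theorem exists_trigPolynomial_eLpNorm_sub_le {μ : Measure Circle} [IsProbabilityMeasure μ]
    {p : ENNReal} (hp1 : 1 ≤ p) (hp : p ≠ ⊤) {φ : Circle → ℂ} (hφ : MemLp φ p μ)
    {ε : ENNReal} (hε : ε ≠ 0) :
    ∃ q ∈ Submodule.span ℂ (Set.range circleZPow), eLpNorm (fun ζ => φ ζ - q ζ) p μ ≤ ε := by
  obtain ⟨δ, hδ0, hδ⟩ := ENNReal.lt_iff_exists_nnreal_btwn.1 (ENNReal.half_pos hε)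
  have hδ0' : (0 : ℝ) < δ := by exact_mod_cast hδ0
  obtain ⟨f, hf, -⟩ := hφ.exists_boundedContinuous_eLpNorm_sub_le hp (ENNReal.half_pos hε).ne'
  obtain ⟨q, hq, hfq⟩ := Metric.dense_iff.1 dense_span_circleZPow f.toContinuousMap δ hδ0'
  refine ⟨q, hfq, ?_⟩
  have h1 : eLpNorm (fun ζ => f ζ - q ζ) p μ ≤ ENNReal.ofReal δ := by
    refine (eLpNorm_le_of_ae_bound (C := (δ : ℝ)) (Eventually.of_forall fun ζ => ?_)).trans ?_
    · rw [← dist_eq_norm, dist_comm]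
      exact (ContinuousMap.dist_apply_le_dist ζ).trans (Metric.mem_ball.1 hq).le
    · simp
  have h2 : (fun ζ => φ ζ - q ζ) = (φ - ⇑f) + fun ζ => f ζ - q ζ := by
    ext ζ; simp
  have hm : AEStronglyMeasurable (fun ζ => f ζ - q ζ) μ :=
    (f.continuous.sub q.continuous).aestronglyMeasurable
  rw [h2]
  refine (eLpNorm_add_le (hφ.1.sub f.continuous.aestronglyMeasurable) hm hp1).trans ?_
  refine (add_le_add hf (h1.trans ?_)).trans_eq (ENNReal.add_halves ε)
  rw [ENNReal.ofReal_coe_nnreal]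
  exact hδ.le

/-! ### Boundary maps of inner functions -/

theorem IsRadialLimit.boundaryMap_eq {g : ℂ → ℂ} {ζ w : Circle} (h : IsRadialLimit g ζ w) :
    boundaryMap g ζ = w := by
  have hex : ∃ w : Circle, IsRadialLimit g ζ w := ⟨w, h⟩
  rw [boundaryMap, dif_pos hex]
  exact Circle.ext (tendsto_nhds_unique hex.choose_spec h)

theorem isInnerFunction_id : IsInnerFunction id where
  differentiableOn := differentiableOn_id
  mapsTo := Set.mapsTo_id _
  radial := Eventually.of_forall fun ζ => ⟨ζ, by
    have : Continuous fun r : ℝ => (r : ℂ) * ζ := by fun_prop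
    simpa [IsRadialLimit] using (this.tendsto 1).mono_left nhdsWithin_le_nhds⟩

theorem boundaryMap_id (ζ : Circle) : boundaryMap id ζ = ζ := by
  apply IsRadialLimit.boundaryMap_eq
  have : Continuous fun r : ℝ => (r : ℂ) * ζ := by fun_prop
  simpa [IsRadialLimit] using (this.tendsto 1).mono_left nhdsWithin_le_nhds

namespace IsInnerFunction
variable {f : ℂ → ℂ}

theorem norm_lt_one (hf : IsInnerFunction f) {z : ℂ} (hz : z ∈ Metric.ball (0 : ℂ) 1) : ‖f z‖ < 1 :=
  mem_ball_zero_iff.1 (hf.mapsTo hz)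

theorem continuous_ofReal_mul (hf : IsInnerFunction f) {r : ℝ} (h0 : 0 ≤ r) (h1 : r < 1) :
    Continuous fun ζ : Circle => f (r * ζ) :=
  continuous_comp_ofReal_mul hf.differentiableOn.continuousOn h0 h1

theorem ae_tendsto (hf : IsInnerFunction f) : ∀ᵐ ζ : Circle ∂circleMeasure,
    Tendsto (fun r : ℝ => f (r * ζ)) (𝓝[<] 1) (𝓝 (boundaryMap f ζ)) := by
  filter_upwards [hf.radial] with ζ ⟨w, hw⟩
  rw [hw.boundaryMap_eq]
  exact hw

end IsInnerFunction

/-- A radial limit function of a function continuous in the disc is measurable. -/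
theorem aemeasurable_of_ae_tendsto_radial {f : ℂ → ℂ}
    (hf : ContinuousOn f (Metric.ball 0 1)) {k : Circle → ℂ}
    (hk : ∀ᵐ ζ : Circle ∂circleMeasure, Tendsto (fun r : ℝ => f (r * ζ)) (𝓝[<] 1) (𝓝 (k ζ))) :
    AEMeasurable k circleMeasure := by
  obtain ⟨r, -, hr, hlim⟩ := exists_seq_strictMono_tendsto' (zero_lt_one' ℝ)
  refine aemeasurable_of_tendsto_metrizable_ae'
    (f := fun n (ζ : Circle) => f ((r n : ℝ) * (ζ : ℂ))) ?_ ?_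
  · exact fun n => (continuous_comp_ofReal_mul hf (hr n).1.le (hr n).2).measurable.aemeasurable
  · filter_upwards [hk] with ζ hζ
    exact hζ.comp (tendsto_nhdsWithin_iff.2 ⟨hlim, Eventually.of_forall fun n => (hr n).2⟩)

theorem measurableEmbedding_circle_coe : MeasurableEmbedding fun ζ : Circle => (ζ : ℂ) :=
  (continuous_circle_coe.isClosedEmbedding Circle.coe_injective).measurableEmbedding

namespace IsInnerFunction
variable {f g : ℂ → ℂ}

theorem aemeasurable_boundaryMap (hf : IsInnerFunction f) :
    AEMeasurable (boundaryMap f) circleMeasure :=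
  measurableEmbedding_circle_coe.aemeasurable_comp_iff.1
    (aemeasurable_of_ae_tendsto_radial hf.differentiableOn.continuousOn hf.ae_tendsto)

theorem aestronglyMeasurable_boundaryMap_zpow (hf : IsInnerFunction f) (n : ℤ) :
    AEStronglyMeasurable (fun ζ => (boundaryMap f ζ : ℂ) ^ n) circleMeasure :=
  ((circleZPow n).continuous.measurable.comp_aemeasurable
    hf.aemeasurable_boundaryMap).aestronglyMeasurable

end IsInnerFunction

theorem norm_circle_zpow (ζ : Circle) (n : ℤ) : ‖(ζ : ℂ) ^ n‖ = 1 := by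
  rw [norm_zpow, Circle.norm_coe, one_zpow]

/-- Dominated convergence along radii, for a bounded analytic function. -/
theorem tendsto_integral_mul_radial {b : ℂ → ℂ} (hb : ContinuousOn b (Metric.ball 0 1)) {C : ℝ}
    (hC : ∀ z ∈ Metric.ball (0 : ℂ) 1, ‖b z‖ ≤ C) {k v : Circle → ℂ}
    (hk : ∀ᵐ ζ : Circle ∂circleMeasure, Tendsto (fun r : ℝ => b (r * ζ)) (𝓝[<] 1) (𝓝 (k ζ)))
    (hv : AEStronglyMeasurable v circleMeasure) (hv1 : ∀ ζ, ‖v ζ‖ ≤ 1) :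
    Tendsto (fun r : ℝ => ∫ ζ : Circle, b (r * ζ) * v ζ ∂circleMeasure) (𝓝[<] 1)
      (𝓝 (∫ ζ, k ζ * v ζ ∂circleMeasure)) := by
  refine tendsto_integral_filter_of_dominated_convergence (fun _ => C) ?_ ?_ (integrable_const _) ?_
  · filter_upwards [eventually_mem_Ioo_nhdsLT_one] with r ⟨h0, h1⟩
    exact (continuous_comp_ofReal_mul hb h0.le h1).aestronglyMeasurable.mul hv
  · filter_upwards [eventually_mem_Ioo_nhdsLT_one] with r ⟨h0, h1⟩
    refine Eventually.of_forall fun ζ => ?_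
    rw [norm_mul]
    have h2 := hC _ (ofReal_mul_coe_mem_ball h0.le h1 ζ)
    exact (mul_le_mul h2 (hv1 ζ) (norm_nonneg _) ((norm_nonneg _).trans h2)).trans_eq (mul_one _)
  · filter_upwards [hk] with ζ hζ
    exact hζ.mul_const _

/-- A bounded weight tending to `0` radially kills a bounded analytic function of `f` in the
limit. -/
theorem tendsto_integral_mul_comp_zero {f : ℂ → ℂ} (hf : IsInnerFunction f) {b : ℂ → ℂ}
    (hb : ContinuousOn b (Metric.ball 0 1)) {C : ℝ} (hC : ∀ z ∈ Metric.ball (0 : ℂ) 1, ‖b z‖ ≤ C)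
    {u : ℝ → Circle → ℂ} {D : ℝ}
    (hu : ∀ r, 0 ≤ r → r < 1 → AEStronglyMeasurable (u r) circleMeasure)
    (huD : ∀ r, 0 ≤ r → r < 1 → ∀ ζ, ‖u r ζ‖ ≤ D)
    (hu0 : ∀ᵐ ζ ∂circleMeasure, Tendsto (fun r => u r ζ) (𝓝[<] 1) (𝓝 0)) :
    Tendsto (fun r : ℝ => ∫ ζ : Circle, b (f (r * ζ)) * u r ζ ∂circleMeasure) (𝓝[<] 1) (𝓝 0) := by
  have hbf : ContinuousOn (fun z => b (f z)) (Metric.ball 0 1) :=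
    hb.comp hf.differentiableOn.continuousOn hf.mapsTo
  rw [show (0 : ℂ) = ∫ _, (0 : ℂ) ∂circleMeasure by simp]
  refine tendsto_integral_filter_of_dominated_convergence (fun _ => C * D) ?_ ?_
    (integrable_const _) ?_
  · filter_upwards [eventually_mem_Ioo_nhdsLT_one] with r ⟨h0, h1⟩
    exact (continuous_comp_ofReal_mul hbf h0.le h1).aestronglyMeasurable.mul (hu r h0.le h1)
  · filter_upwards [eventually_mem_Ioo_nhdsLT_one] with r ⟨h0, h1⟩
    refine Eventually.of_forall fun ζ => ?_
    rw [norm_mul]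
    have h2 := hC _ (hf.mapsTo (ofReal_mul_coe_mem_ball h0.le h1 ζ))
    exact mul_le_mul h2 (huD r h0.le h1 ζ) (norm_nonneg _) ((norm_nonneg _).trans h2)
  · filter_upwards [hu0] with ζ hζ
    refine squeeze_zero_norm' ?_ (by simpa using hζ.norm.const_mul C)
    filter_upwards [eventually_mem_Ioo_nhdsLT_one] with r ⟨h0, h1⟩
    rw [norm_mul]
    exact mul_le_mul_of_nonneg_right (hC _ (hf.mapsTo (ofReal_mul_coe_mem_ball h0.le h1 ζ)))
      (norm_nonneg _)

theorem differentiableOn_dslope_zero {b : ℂ → ℂ} (hb : DifferentiableOn ℂ b (Metric.ball 0 1)) :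
    DifferentiableOn ℂ (dslope b 0) (Metric.ball 0 1) :=
  (Complex.differentiableOn_dslope (Metric.ball_mem_nhds _ one_pos)).2 hb

theorem eq_add_mul_dslope (b : ℂ → ℂ) (z : ℂ) : b z = b 0 + z * dslope b 0 z := by
  have := sub_smul_dslope b 0 z
  rw [sub_zero, smul_eq_mul] at this
  rw [this]; ring

namespace IsInnerFunction
variable {f : ℂ → ℂ}

theorem integrable_comp_mul (hf : IsInnerFunction f) {b : ℂ → ℂ}
    (hb : ContinuousOn b (Metric.ball 0 1)) {C : ℝ} (hC : ∀ z ∈ Metric.ball (0 : ℂ) 1, ‖b z‖ ≤ C)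
    {r : ℝ} (h0 : 0 ≤ r) (h1 : r < 1) {u : Circle → ℂ} {D : ℝ}
    (hu : AEStronglyMeasurable u circleMeasure) (huD : ∀ ζ, ‖u ζ‖ ≤ D) :
    Integrable (fun ζ : Circle => b (f (r * ζ)) * u ζ) circleMeasure := by
  have hbf : ContinuousOn (fun z => b (f z)) (Metric.ball 0 1) :=
    hb.comp hf.differentiableOn.continuousOn hf.mapsTo
  refine Integrable.of_bound (C := C * D)
    ((continuous_comp_ofReal_mul hbf h0 h1).aestronglyMeasurable.mul hu) ?_
  refine Eventually.of_forall fun ζ => ?_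
  rw [norm_mul]
  have h2 := hC _ (hf.mapsTo (ofReal_mul_coe_mem_ball h0 h1 ζ))
  exact mul_le_mul h2 (huD ζ) (norm_nonneg _) ((norm_nonneg _).trans h2)

theorem tendsto_integral_comp_mul_pow (hf : IsInnerFunction f)
    (hf0 : f 0 = 0) {b : ℂ → ℂ} (hb : DifferentiableOn ℂ b (Metric.ball 0 1)) {C : ℝ}
    (hC : ∀ z ∈ Metric.ball (0 : ℂ) 1, ‖b z‖ ≤ C) (j : ℕ) :
    Tendsto (fun r : ℝ => ∫ ζ : Circle, b (f (r * ζ)) * (boundaryMap f ζ : ℂ) ^ j ∂circleMeasure)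
      (𝓝[<] 1) (𝓝 (b 0 * 0 ^ j)) := by
  have hm : ∀ r : ℝ, 0 ≤ r → r < 1 → AEStronglyMeasurable
      (fun ζ : Circle => (boundaryMap f ζ : ℂ) ^ j - f (r * ζ) ^ j) circleMeasure :=
    fun r h0 h1 => (hf.aestronglyMeasurable_boundaryMap_zpow j).sub
        ((hf.continuous_ofReal_mul h0 h1).pow j).aestronglyMeasurable
  have hbd : ∀ r : ℝ, 0 ≤ r → r < 1 → ∀ ζ : Circle,
      ‖(boundaryMap f ζ : ℂ) ^ j - f (r * ζ) ^ j‖ ≤ 2 := by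
    intro r h0 h1 ζ
    refine (norm_sub_le _ _).trans ?_
    rw [norm_pow, norm_pow, Circle.norm_coe, one_pow]
    have := pow_le_one₀ (n := j) (norm_nonneg _)
      (hf.norm_lt_one (ofReal_mul_coe_mem_ball h0 h1 ζ)).le
    linarith
  have h1 := tendsto_integral_mul_comp_zero hf hb.continuousOn hC hm hbd ?_
  · have h2 := h1.add_const (b 0 * 0 ^ j)
    rw [zero_add] at h2
    refine h2.congr' ?_
    filter_upwards [eventually_mem_Ioo_nhdsLT_one] with r ⟨h0, h1⟩
    have hd : DifferentiableOn ℂ (fun z => b (f z) * f z ^ j) (Metric.ball 0 1) :=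
      (hb.comp hf.differentiableOn hf.mapsTo).mul (hf.differentiableOn.pow j)
    have h3 := integral_circleMeasure_ofReal_mul hd h0.le h1
    rw [hf0] at h3
    rw [← h3, ← integral_add (hf.integrable_comp_mul hb.continuousOn hC h0.le h1
      (hm r h0.le h1) (hbd r h0.le h1))]
    · congr 1; ext ζ; ring
    · exact (continuous_comp_ofReal_mul hd.continuousOn h0.le h1).integrable_of_hasCompactSupport
        (HasCompactSupport.of_compactSpace _)
  · filter_upwards [hf.ae_tendsto] with ζ hζ
    have := (hζ.pow j).const_sub ((boundaryMap f ζ : ℂ) ^ j)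
    rwa [sub_self] at this

theorem integral_boundaryMap_pow (hf : IsInnerFunction f) (hf0 : f 0 = 0) {j : ℕ} (hj : j ≠ 0) :
    ∫ ζ, (boundaryMap f ζ : ℂ) ^ j ∂circleMeasure = 0 := by
  have h := hf.tendsto_integral_comp_mul_pow hf0 (b := fun _ => 1) (by fun_prop) (C := 1)
    (by simp) j
  simp only [one_mul, zero_pow hj] at h
  exact tendsto_nhds_unique tendsto_const_nhds h

theorem integral_boundaryMap_inv_pow (hf : IsInnerFunction f) (hf0 : f 0 = 0) {j : ℕ}
    (hj : j ≠ 0) : ∫ ζ, ((boundaryMap f ζ : ℂ)⁻¹) ^ j ∂circleMeasure = 0 := by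
  have h : ∀ ζ, ((boundaryMap f ζ : ℂ)⁻¹) ^ j = (starRingEnd ℂ) ((boundaryMap f ζ : ℂ) ^ j) := by
    intro ζ
    rw [map_pow, ← Circle.coe_inv_eq_conj, Circle.coe_inv]
  simp_rw [h]
  rw [integral_conj, hf.integral_boundaryMap_pow hf0 hj, map_zero]

theorem aestronglyMeasurable_boundaryMap_inv_pow (hf : IsInnerFunction f) (j : ℕ) :
    AEStronglyMeasurable (fun ζ => ((boundaryMap f ζ : ℂ)⁻¹) ^ j) circleMeasure := by
  simpa using hf.aestronglyMeasurable_boundaryMap_zpow (-j)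

theorem norm_boundaryMap_inv_pow (ζ : Circle) (j : ℕ) : ‖((boundaryMap f ζ : ℂ)⁻¹) ^ j‖ = 1 := by
  rw [norm_pow, norm_inv, Circle.norm_coe, inv_one, one_pow]

/-- The radial limit of `f · conj (boundary value of f)` is one. -/
theorem ae_tendsto_mul_inv (hf : IsInnerFunction f) : ∀ᵐ ζ : Circle ∂circleMeasure,
    Tendsto (fun r : ℝ => f (r * ζ) * (boundaryMap f ζ : ℂ)⁻¹) (𝓝[<] 1) (𝓝 1) := by
  filter_upwards [hf.ae_tendsto] with ζ hζ
  have := hζ.mul_const ((boundaryMap f ζ : ℂ)⁻¹)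
  rwa [mul_inv_cancel₀ (Circle.coe_ne_zero _)] at this

theorem norm_mul_inv_le_one (hf : IsInnerFunction f) {r : ℝ} (h0 : 0 ≤ r) (h1 : r < 1)
    (ζ : Circle) : ‖f (r * ζ) * (boundaryMap f ζ : ℂ)⁻¹‖ ≤ 1 := by
  rw [norm_mul, norm_inv, Circle.norm_coe, inv_one, mul_one]
  exact (hf.norm_lt_one (ofReal_mul_coe_mem_ball h0 h1 ζ)).le

theorem aestronglyMeasurable_mul_inv (hf : IsInnerFunction f) {r : ℝ} (h0 : 0 ≤ r) (h1 : r < 1) :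
    AEStronglyMeasurable (fun ζ : Circle => f (r * ζ) * (boundaryMap f ζ : ℂ)⁻¹) circleMeasure := by
  have := hf.aestronglyMeasurable_boundaryMap_inv_pow 1
  simp only [pow_one] at this
  exact (hf.continuous_ofReal_mul h0 h1).aestronglyMeasurable.mul this

end IsInnerFunction

theorem norm_dslope_zero_le {b : ℂ → ℂ} (hb : DifferentiableOn ℂ b (Metric.ball 0 1)) {C : ℝ}
    (hC : ∀ z ∈ Metric.ball (0 : ℂ) 1, ‖b z‖ ≤ C) :
    ∀ z ∈ Metric.ball (0 : ℂ) 1, ‖dslope b 0 z‖ ≤ 2 * C := by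
  intro z hz
  have := Complex.norm_dslope_le_div_of_mapsTo_ball (R₂ := 2 * C) hb (fun w hw => ?_) hz
  · simpa using this
  · rw [mem_closedBall_iff_norm]
    have := hC w hw
    have := hC 0 (Metric.mem_ball_self one_pos)
    linarith [norm_sub_le (b w) (b 0)]

/-- The limit is the `j`-th Taylor coefficient of `b`; only its independence of `f` matters. -/
theorem exists_tendsto_integral_comp_mul_inv_pow (j : ℕ) : ∀ {b : ℂ → ℂ},
    DifferentiableOn ℂ b (Metric.ball 0 1) → ∀ {C : ℝ}, (∀ z ∈ Metric.ball (0 : ℂ) 1, ‖b z‖ ≤ C) →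
    ∃ c : ℂ, ∀ f : ℂ → ℂ, IsInnerFunction f → f 0 = 0 →
      Tendsto (fun r : ℝ => ∫ ζ : Circle, b (f (r * ζ)) * ((boundaryMap f ζ : ℂ)⁻¹) ^ j
        ∂circleMeasure) (𝓝[<] 1) (𝓝 c) := by
  induction j with
  | zero =>
    intro b hb C hC
    refine ⟨b 0 * 0 ^ 0, fun f hf hf0 => ?_⟩
    simpa using hf.tendsto_integral_comp_mul_pow hf0 hb hC 0
  | succ j ih =>
    intro b hb C hC
    have hb' := differentiableOn_dslope_zero hb
    have hC' := norm_dslope_zero_le hb hC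
    obtain ⟨c, hc⟩ := ih hb' hC'
    refine ⟨c, fun f hf hf0 => ?_⟩
    set T : Circle → ℂ := fun ζ => (boundaryMap f ζ : ℂ)⁻¹ with hT
    have hm : ∀ r : ℝ, 0 ≤ r → r < 1 → AEStronglyMeasurable
        (fun ζ : Circle => (f (r * ζ) * T ζ - 1) * T ζ ^ j) circleMeasure := fun r h0 h1 =>
      ((hf.aestronglyMeasurable_mul_inv h0 h1).sub aestronglyMeasurable_const).mul
        (hf.aestronglyMeasurable_boundaryMap_inv_pow j)
    have hbd : ∀ r : ℝ, 0 ≤ r → r < 1 → ∀ ζ : Circle,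
        ‖(f (r * ζ) * T ζ - 1) * T ζ ^ j‖ ≤ 2 := by
      intro r h0 h1 ζ
      rw [norm_mul, IsInnerFunction.norm_boundaryMap_inv_pow, mul_one]
      have := hf.norm_mul_inv_le_one h0 h1 ζ
      refine (norm_sub_le _ _).trans ?_
      rw [norm_one]; linarith
    have h1 := tendsto_integral_mul_comp_zero hf hb'.continuousOn hC' hm hbd ?_
    · have h2 := (hc f hf hf0).add h1
      rw [add_zero] at h2
      refine h2.congr' ?_
      filter_upwards [eventually_mem_Ioo_nhdsLT_one] with r ⟨h0, h1⟩
      have i1 := hf.integrable_comp_mul hb'.continuousOn hC' h0.le h1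
        (hf.aestronglyMeasurable_boundaryMap_inv_pow j)
        (fun ζ => (IsInnerFunction.norm_boundaryMap_inv_pow ζ j).le)
      have i2 := hf.integrable_comp_mul hb'.continuousOn hC' h0.le h1 (hm r h0.le h1)
        (hbd r h0.le h1)
      have i3 : Integrable (fun ζ => b 0 * T ζ ^ (j + 1)) circleMeasure :=
        (Integrable.of_bound (hf.aestronglyMeasurable_boundaryMap_inv_pow (j + 1)) 1
          (Eventually.of_forall fun ζ =>
            (IsInnerFunction.norm_boundaryMap_inv_pow ζ (j + 1)).le)).const_mul _
      have z3 : ∫ ζ, b 0 * T ζ ^ (j + 1) ∂circleMeasure = 0 := by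
        rw [integral_const_mul, hf.integral_boundaryMap_inv_pow hf0 j.succ_ne_zero, mul_zero]
      have hsum := integral_add (i1.add i2) i3
      rw [z3, add_zero, integral_add' i1 i2] at hsum
      refine hsum.symm.trans (integral_congr_ae (Eventually.of_forall fun ζ => ?_))
      change dslope b 0 (f (r * ζ)) * T ζ ^ j +
        dslope b 0 (f (r * ζ)) * ((f (r * ζ) * T ζ - 1) * T ζ ^ j) + b 0 * T ζ ^ (j + 1) =
        b (f (r * ζ)) * T ζ ^ (j + 1)
      rw [eq_add_mul_dslope b (f (r * ζ))]
      ring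
    · filter_upwards [hf.ae_tendsto_mul_inv] with ζ hζ
      simpa using (hζ.sub_const 1).mul_const (T ζ ^ j)

theorem exists_tendsto_integral_comp_mul_zpow {b : ℂ → ℂ}
    (hb : DifferentiableOn ℂ b (Metric.ball 0 1)) {C : ℝ}
    (hC : ∀ z ∈ Metric.ball (0 : ℂ) 1, ‖b z‖ ≤ C) (n : ℤ) :
    ∃ c : ℂ, ∀ f : ℂ → ℂ, IsInnerFunction f → f 0 = 0 →
      Tendsto (fun r : ℝ => ∫ ζ : Circle, b (f (r * ζ)) * (boundaryMap f ζ : ℂ) ^ n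
        ∂circleMeasure) (𝓝[<] 1) (𝓝 c) := by
  obtain ⟨j, rfl | rfl⟩ := n.eq_nat_or_neg
  · exact ⟨_, fun f hf hf0 => by
      simpa only [zpow_natCast] using hf.tendsto_integral_comp_mul_pow hf0 hb hC j⟩
  · obtain ⟨c, hc⟩ := exists_tendsto_integral_comp_mul_inv_pow j hb hC
    exact ⟨c, fun f hf hf0 => by
      simpa only [zpow_neg, zpow_natCast, inv_pow] using hc f hf hf0⟩

/-- **Löwner's lemma**: the boundary map of an inner function fixing the origin preserves
normalised Lebesgue measure. -/
theorem IsInnerFunction.map_boundaryMap {f : ℂ → ℂ} (hf : IsInnerFunction f) (hf0 : f 0 = 0) :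
    circleMeasure.map (boundaryMap f) = circleMeasure := by
  refine map_eq_of_integral_zpow hf.aemeasurable_boundaryMap fun n => ?_
  obtain ⟨c, hc⟩ := exists_tendsto_integral_comp_mul_zpow (b := fun _ => 1) (by fun_prop) (C := 1)
    (by simp) n
  have h1 := hc f hf hf0
  have h2 := hc id isInnerFunction_id rfl
  simp only [one_mul, boundaryMap_id] at h1 h2
  exact (tendsto_nhds_unique tendsto_const_nhds h1).trans
    (tendsto_nhds_unique tendsto_const_nhds h2).symm

/-- The composition of inner functions is inner. By Fatou's theorem `g ∘ f` has a radial limit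
function `k`, which has the same Fourier coefficients relative to the boundary map of `f` as `g` has
relative to the identity. So `k` agrees in the mean with the composed boundary maps, and a function
bounded by one with this property is unimodular. -/
theorem IsInnerFunction.comp {f g : ℂ → ℂ} (hg : IsInnerFunction g) (hf : IsInnerFunction f)
    (hf0 : f 0 = 0) : IsInnerFunction (g ∘ f) := by
  have hd : DifferentiableOn ℂ (g ∘ f) (Metric.ball 0 1) :=
    hg.differentiableOn.comp hf.differentiableOn hf.mapsTo
  have hm : Set.MapsTo (g ∘ f) (Metric.ball 0 1) (Metric.ball 0 1) := hg.mapsTo.comp hf.mapsTo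
  have hb : ∀ {h : ℂ → ℂ}, Set.MapsTo h (Metric.ball 0 1) (Metric.ball 0 1) →
      ∀ z ∈ Metric.ball (0 : ℂ) 1, ‖h z‖ ≤ 1 := fun hh z hz =>
    (mem_ball_zero_iff.1 (hh hz)).le
  obtain ⟨k, hk⟩ : ∃ k : Circle → ℂ, ∀ᵐ ζ : Circle ∂circleMeasure,
      Tendsto (fun r : ℝ => (g ∘ f) (r * ζ)) (𝓝[<] 1) (𝓝 (k ζ)) := by
    classical
    refine ⟨fun ζ => if h : ∃ w, Tendsto (fun r : ℝ => (g ∘ f) (r * ζ)) (𝓝[<] 1) (𝓝 w)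
      then h.choose else 0, ?_⟩
    filter_upwards [ae_exists_tendsto_radial hd (hb hm)] with ζ hζ
    rw [dif_pos hζ]
    exact hζ.choose_spec
  have hkm : AEStronglyMeasurable k circleMeasure :=
    (aemeasurable_of_ae_tendsto_radial hd.continuousOn hk).aestronglyMeasurable
  have hk1 : ∀ᵐ ζ ∂circleMeasure, ‖k ζ‖ ≤ 1 := by
    filter_upwards [hk] with ζ hζ
    refine le_of_tendsto hζ.norm ?_
    filter_upwards [eventually_mem_Ioo_nhdsLT_one] with r ⟨h0, h1⟩
    exact hb hm _ (ofReal_mul_coe_mem_ball h0.le h1 ζ)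
  set γ : Circle → ℂ := fun ζ => boundaryMap g ζ with hγ
  have hγm : AEStronglyMeasurable γ circleMeasure := by
    simpa using hg.aestronglyMeasurable_boundaryMap_zpow 1
  have hγ1 : ∀ ζ, ‖γ ζ‖ = 1 := fun ζ => Circle.norm_coe _
  set T := boundaryMap f with hT
  have hTm : AEMeasurable T circleMeasure := hf.aemeasurable_boundaryMap
  have hcont : ∀ φ : C(Circle, ℂ),
      ∫ ζ, k ζ * φ (T ζ) ∂circleMeasure = ∫ ζ, γ ζ * φ ζ ∂circleMeasure := by
    refine integral_mul_comp_eq_of_zpow (S := id) hkm hk1 hTm hγm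
      (Eventually.of_forall fun ζ => (hγ1 ζ).le) aemeasurable_id fun n => ?_
    obtain ⟨c, hc⟩ := exists_tendsto_integral_comp_mul_zpow hg.differentiableOn (hb hg.mapsTo) n
    have h1 := tendsto_nhds_unique (hc f hf hf0) (tendsto_integral_mul_radial hd.continuousOn
      (hb hm) hk (hf.aestronglyMeasurable_boundaryMap_zpow n) fun ζ => (norm_circle_zpow _ n).le)
    have h2 := tendsto_nhds_unique (hc id isInnerFunction_id rfl)
      (tendsto_integral_mul_radial hg.differentiableOn.continuousOn (hb hg.mapsTo) hg.ae_tendsto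
        (isInnerFunction_id.aestronglyMeasurable_boundaryMap_zpow n)
        fun ζ => (norm_circle_zpow _ n).le)
    rw [← h1, h2]
    simp only [boundaryMap_id, id]
    rfl
  -- the identity `hcont` extends from continuous functions to the bounded function `conj γ`
  set δ : Circle → ℂ := fun ζ => (starRingEnd ℂ) (γ ζ) with hδ
  have hδm : AEStronglyMeasurable δ circleMeasure :=
    Complex.continuous_conj.comp_aestronglyMeasurable hγm
  have hδ1 : ∀ ζ, ‖δ ζ‖ = 1 := fun ζ => by simp only [hδ, RCLike.norm_conj, hγ1]
  have hδmap : AEStronglyMeasurable δ (circleMeasure.map T) := by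
    rw [hf.map_boundaryMap hf0]; exact hδm
  have hδT : AEStronglyMeasurable (fun ζ => δ (T ζ)) circleMeasure := hδmap.comp_aemeasurable hTm
  have hγδ : ∀ ζ, γ ζ * δ ζ = 1 := fun ζ => by
    simp only [hδ, hγ, Complex.mul_conj, Circle.normSq_coe, Complex.ofReal_one]
  have hone : ∫ ζ, k ζ * δ (T ζ) ∂circleMeasure = 1 := by
    refine eq_of_forall_dist_le fun ε hε => ?_
    have hδL : MemLp δ 1 circleMeasure :=
      MemLp.of_bound hδm 1 (Eventually.of_forall fun ζ => (hδ1 ζ).le)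
    obtain ⟨q, -, hq⟩ := exists_trigPolynomial_eLpNorm_sub_le le_rfl ENNReal.one_ne_top hδL
      (ENNReal.ofReal_pos.2 (half_pos hε)).ne'
    have hqm : AEStronglyMeasurable (fun ζ => δ ζ - q ζ) circleMeasure :=
      hδm.sub q.continuous.aestronglyMeasurable
    have hqi : Integrable (fun ζ => δ ζ - q ζ) circleMeasure := by
      refine Integrable.of_bound hqm (1 + ‖q‖) (Eventually.of_forall fun ζ => ?_)
      exact (norm_sub_le _ _).trans (add_le_add (hδ1 ζ).le (q.norm_coe_le_norm ζ))
    have hq2 : ∫ ζ, ‖δ ζ - q ζ‖ ∂circleMeasure ≤ ε / 2 := by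
      rw [eLpNorm_one_eq_lintegral_enorm] at hq
      rw [integral_norm_eq_lintegral_enorm hqm]
      exact ENNReal.toReal_le_of_le_ofReal (half_pos hε).le hq
    have hqmap : AEStronglyMeasurable (fun ζ => ‖δ ζ - q ζ‖) (circleMeasure.map T) := by
      rw [hf.map_boundaryMap hf0]; exact hqm.norm
    have hqT : ∫ ζ, ‖δ (T ζ) - q (T ζ)‖ ∂circleMeasure ≤ ε / 2 := by
      rw [← integral_map (f := fun ζ => ‖δ ζ - q ζ‖) hTm hqmap, hf.map_boundaryMap hf0]
      exact hq2
    have hqTm : AEStronglyMeasurable (fun ζ => q (T ζ)) circleMeasure :=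
      (q.continuous.measurable.comp_aemeasurable hTm).aestronglyMeasurable
    have hqTi : Integrable (fun ζ => δ (T ζ) - q (T ζ)) circleMeasure := by
      refine Integrable.of_bound (hδT.sub hqTm) (1 + ‖q‖) (Eventually.of_forall fun ζ => ?_)
      exact (norm_sub_le _ _).trans (add_le_add (hδ1 _).le (q.norm_coe_le_norm _))
    have e1 : ∫ ζ, k ζ * (δ (T ζ) - q (T ζ)) ∂circleMeasure =
        ∫ ζ, k ζ * δ (T ζ) ∂circleMeasure - ∫ ζ, k ζ * q (T ζ) ∂circleMeasure := by
      simp only [mul_sub]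
      refine integral_sub (Integrable.of_bound (hkm.mul hδT) 1 ?_)
        (Integrable.of_bound (hkm.mul hqTm) ‖q‖ ?_)
      · filter_upwards [hk1] with ζ hζ
        rw [norm_mul, hδ1, mul_one]; exact hζ
      · filter_upwards [hk1] with ζ hζ
        rw [norm_mul]
        exact (mul_le_mul hζ (q.norm_coe_le_norm _) (norm_nonneg _) zero_le_one).trans_eq
          (one_mul _)
    have e2 : ∫ ζ, γ ζ * (δ ζ - q ζ) ∂circleMeasure =
        1 - ∫ ζ, γ ζ * q ζ ∂circleMeasure := by
      simp only [mul_sub]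
      have i1 : Integrable (fun ζ => γ ζ * δ ζ) circleMeasure := by
        simp only [hγδ]; exact integrable_const 1
      have i2 : Integrable (fun ζ => γ ζ * q ζ) circleMeasure := by
        refine Integrable.of_bound (hγm.mul q.continuous.aestronglyMeasurable) ‖q‖
          (Eventually.of_forall fun ζ => ?_)
        rw [norm_mul, hγ1, one_mul]; exact q.norm_coe_le_norm _
      rw [integral_sub i1 i2]
      simp only [hγδ, integral_const, probReal_univ, one_smul]
    have e3 : ∫ ζ, k ζ * δ (T ζ) ∂circleMeasure - 1 =
        ∫ ζ, k ζ * (δ (T ζ) - q (T ζ)) ∂circleMeasure -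
          ∫ ζ, γ ζ * (δ ζ - q ζ) ∂circleMeasure := by
      rw [e1, e2, hcont q]; ring
    rw [dist_eq_norm, e3]
    refine (norm_sub_le _ _).trans ?_
    have b1 : ‖∫ ζ, k ζ * (δ (T ζ) - q (T ζ)) ∂circleMeasure‖ ≤ ε / 2 := by
      refine (norm_integral_le_of_norm_le hqTi.norm ?_).trans hqT
      filter_upwards [hk1] with ζ hζ
      rw [norm_mul]
      exact mul_le_of_le_one_left (norm_nonneg _) hζ
    have b2 : ‖∫ ζ, γ ζ * (δ ζ - q ζ) ∂circleMeasure‖ ≤ ε / 2 := by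
      refine (norm_integral_le_of_norm_le hqi.norm (Eventually.of_forall fun ζ => ?_)).trans hq2
      rw [norm_mul, hγ1, one_mul]
    linarith
  have hki : Integrable k circleMeasure := Integrable.of_bound hkm 1 hk1
  have hle : (1 : ℝ) ≤ ∫ ζ, ‖k ζ‖ ∂circleMeasure := by
    have h := norm_integral_le_integral_norm (μ := circleMeasure) fun ζ => k ζ * δ (T ζ)
    simpa only [hone, norm_one, norm_mul, hδ1, mul_one] using h
  have hzero : ∫ ζ, (1 - ‖k ζ‖) ∂circleMeasure = 0 := by
    have hnn : 0 ≤ ∫ ζ, (1 - ‖k ζ‖) ∂circleMeasure := by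
      refine integral_nonneg_of_ae ?_
      filter_upwards [hk1] with ζ hζ using sub_nonneg.2 hζ
    have h := integral_sub (integrable_const (1 : ℝ)) hki.norm
    simp only [integral_const, probReal_univ, one_smul] at h
    linarith
  have hnorm := (integral_eq_zero_iff_of_nonneg_ae (by
    filter_upwards [hk1] with ζ hζ using sub_nonneg.2 hζ)
    ((integrable_const (1 : ℝ)).sub hki.norm)).1 hzero
  refine ⟨hd, hm, ?_⟩
  filter_upwards [hk, hnorm] with ζ hζ h1
  have h1' : ‖k ζ‖ = 1 := (sub_eq_zero.1 h1).symm
  exact ⟨⟨k ζ, mem_sphere_zero_iff_norm.2 h1'⟩, hζ⟩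

/-! ### Correlations of the compositions -/

/-- If `f` and `h ∘ f` are inner and `h` fixes the origin, then the correlation of the `k`-th powers
of their boundary maps is `h' 0 ^ k`. -/
theorem IsInnerFunction.integral_comp_pow_mul_inv_pow {f h : ℂ → ℂ} (hf : IsInnerFunction f)
    (hf0 : f 0 = 0) (hd : DifferentiableOn ℂ h (Metric.ball 0 1))
    (hm : Set.MapsTo h (Metric.ball 0 1) (Metric.ball 0 1)) (h0 : h 0 = 0)
    (hhf : IsInnerFunction (h ∘ f)) (k : ℕ) :
    ∫ ζ, (boundaryMap (h ∘ f) ζ : ℂ) ^ k * ((boundaryMap f ζ : ℂ)⁻¹) ^ k ∂circleMeasure =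
      deriv h 0 ^ k := by
  set q : ℂ → ℂ := fun z => dslope h 0 z ^ k with hq
  have hqd : DifferentiableOn ℂ q (Metric.ball 0 1) := (differentiableOn_dslope_zero hd).pow k
  have hq1 : ∀ z ∈ Metric.ball (0 : ℂ) 1, ‖q z‖ ≤ 1 := by
    intro z hz
    rw [hq, norm_pow]
    refine pow_le_one₀ (norm_nonneg _) ?_
    have := Complex.norm_dslope_le_div_of_mapsTo_ball (R₂ := 1) hd (fun w hw => ?_) hz
    · simpa using this
    · rw [h0]; exact Metric.ball_subset_closedBall (hm hw)
  set T : Circle → ℂ := fun ζ => (boundaryMap f ζ : ℂ)⁻¹ with hT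
  -- the left side as a radial limit
  have hlim : Tendsto (fun r : ℝ => ∫ ζ : Circle, (h ∘ f) (r * ζ) ^ k * T ζ ^ k ∂circleMeasure)
      (𝓝[<] 1) (𝓝 (∫ ζ, (boundaryMap (h ∘ f) ζ : ℂ) ^ k * T ζ ^ k ∂circleMeasure)) := by
    refine tendsto_integral_mul_radial (b := fun z => (h ∘ f) z ^ k) (C := 1)
      (hhf.differentiableOn.pow k).continuousOn (fun z hz => ?_) ?_
      (hf.aestronglyMeasurable_boundaryMap_inv_pow k)
      fun ζ => (IsInnerFunction.norm_boundaryMap_inv_pow ζ k).le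
    · rw [norm_pow]
      exact pow_le_one₀ (norm_nonneg _) (hhf.norm_lt_one hz).le
    · filter_upwards [hhf.ae_tendsto] with ζ hζ using hζ.pow k
  have hmeas : ∀ r : ℝ, 0 ≤ r → r < 1 → AEStronglyMeasurable
      (fun ζ : Circle => (f (r * ζ) * T ζ) ^ k - 1) circleMeasure := fun r h0 h1 =>
    ((hf.aestronglyMeasurable_mul_inv h0 h1).pow k).sub aestronglyMeasurable_const
  have hbd : ∀ r : ℝ, 0 ≤ r → r < 1 → ∀ ζ : Circle, ‖(f (r * ζ) * T ζ) ^ k - 1‖ ≤ 2 := by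
    intro r h0 h1 ζ
    refine (norm_sub_le _ _).trans ?_
    rw [norm_one, norm_pow]
    have := pow_le_one₀ (n := k) (norm_nonneg _) (hf.norm_mul_inv_le_one h0 h1 ζ)
    linarith
  have h1 := tendsto_integral_mul_comp_zero hf hqd.continuousOn hq1 hmeas hbd (by
    filter_upwards [hf.ae_tendsto_mul_inv] with ζ hζ
    simpa using (hζ.pow k).sub_const 1)
  have h2 := h1.add_const (deriv h 0 ^ k)
  rw [zero_add] at h2
  refine tendsto_nhds_unique hlim (h2.congr' ?_)
  filter_upwards [eventually_mem_Ioo_nhdsLT_one] with r ⟨r0, r1⟩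
  have hqf : DifferentiableOn ℂ (fun z => q (f z)) (Metric.ball 0 1) :=
    hqd.comp hf.differentiableOn hf.mapsTo
  have h3 := integral_circleMeasure_ofReal_mul hqf r0.le r1
  have hq0 : q 0 = deriv h 0 ^ k := by simp only [hq, dslope_same]
  rw [hf0, hq0] at h3
  rw [← h3, ← integral_add (hf.integrable_comp_mul hqd.continuousOn hq1 r0.le r1
    (hmeas r r0.le r1) (hbd r r0.le r1))]
  · refine integral_congr_ae (Eventually.of_forall fun ζ => ?_)
    have h4 := eq_add_mul_dslope h (f (r * ζ))
    rw [h0, zero_add] at h4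
    simp only [Function.comp, hq, h4]
    ring
  · exact (continuous_comp_ofReal_mul hqf.continuousOn r0.le r1).integrable_of_hasCompactSupport
      (HasCompactSupport.of_compactSpace _)

section compSeq
variable {g : ℕ → ℂ → ℂ}

theorem isInnerFunction_compSeq (hg : ∀ n, 1 ≤ n → IsInnerFunction (g n) ∧ g n 0 = 0) (n : ℕ) :
    IsInnerFunction (compSeq g n) ∧ compSeq g n 0 = 0 := by
  induction n with
  | zero => exact ⟨isInnerFunction_id, rfl⟩
  | succ n ih =>
    obtain ⟨h1, h2⟩ := hg (n + 1) (by omega)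
    refine ⟨h1.comp ih.1 ih.2, ?_⟩
    simp [compSeq, ih.2, h2]

/-- The later composition factors through the earlier one. The factor is an analytic self-map of the
disc; that it is inner plays no role. -/
theorem exists_compSeq_eq_comp (hg : ∀ n, 1 ≤ n → IsInnerFunction (g n) ∧ g n 0 = 0) {m n : ℕ}
    (hmn : m ≤ n) : ∃ h : ℂ → ℂ, DifferentiableOn ℂ h (Metric.ball 0 1) ∧
      Set.MapsTo h (Metric.ball 0 1) (Metric.ball 0 1) ∧ h 0 = 0 ∧
      deriv h 0 = ∏ j ∈ Finset.Ioc m n, deriv (g j) 0 ∧ compSeq g n = h ∘ compSeq g m := by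
  induction n, hmn using Nat.le_induction with
  | base => exact ⟨id, differentiableOn_id, Set.mapsTo_id _, rfl, by simp, rfl⟩
  | succ n hmn ih =>
    obtain ⟨h, hd, hm, h0, hder, heq⟩ := ih
    obtain ⟨h1, h2⟩ := hg (n + 1) (by omega)
    refine ⟨g (n + 1) ∘ h, h1.differentiableOn.comp hd hm, h1.mapsTo.comp hm, by simp [h0, h2],
      ?_, by rw [compSeq, heq]; rfl⟩
    have hb : Metric.ball (0 : ℂ) 1 ∈ 𝓝 0 := Metric.ball_mem_nhds _ one_pos
    rw [deriv_comp, h0, hder, ← Finset.insert_Ioc_right_eq_Ioc_add_one hmn,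
      Finset.prod_insert (by simp)]
    · rw [h0]; exact h1.differentiableOn.differentiableAt hb
    · exact hd.differentiableAt hb

theorem integral_boundaryMap_compSeq (hg : ∀ n, 1 ≤ n → IsInnerFunction (g n) ∧ g n 0 = 0)
    {m n : ℕ} (hmn : m ≤ n) (k : ℕ) :
    ∫ ζ, (boundaryMap (compSeq g n) ζ : ℂ) ^ k * ((boundaryMap (compSeq g m) ζ : ℂ)⁻¹) ^ k
      ∂circleMeasure = (∏ j ∈ Finset.Ioc m n, deriv (g j) 0) ^ k := by
  obtain ⟨h, hd, hm, h0, hder, heq⟩ := exists_compSeq_eq_comp hg hmn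
  obtain ⟨h1, h2⟩ := isInnerFunction_compSeq hg m
  have h3 := (isInnerFunction_compSeq hg n).1
  rw [heq] at h3
  rw [heq, ← hder]
  exact h1.integral_comp_pow_mul_inv_pow h2 hd hm h0 h3 k

end compSeq

/-! ### Averages in Hilbert spaces -/

section Hilbert
variable {H : Type*} [NormedAddCommGroup H] [InnerProductSpace ℂ H]

theorem sum_pow_sub_le {q : ℝ} (hq0 : 0 ≤ q) (hq1 : q < 1) (N : ℕ) :
    ∑ i ∈ Finset.range N, q ^ (N - i) ≤ (1 - q)⁻¹ := by
  have h : ∑ i ∈ Finset.range N, q ^ (N - i) = ∑ i ∈ Finset.range N, q ^ (i + 1) := by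
    rw [← Finset.sum_range_reflect]
    refine Finset.sum_congr rfl fun i hi => ?_
    rw [Finset.mem_range] at hi
    congr 1; omega
  rw [h]
  calc ∑ i ∈ Finset.range N, q ^ (i + 1) ≤ ∑ i ∈ Finset.range N, q ^ i :=
        Finset.sum_le_sum fun i _ => pow_le_pow_of_le_one hq0 hq1.le (Nat.le_succ i)
    _ ≤ ∑' i, q ^ i := (summable_geometric_of_lt_one hq0 hq1).sum_le_tsum _
        fun i _ => pow_nonneg hq0 i
    _ = (1 - q)⁻¹ := tsum_geometric_of_lt_one hq0 hq1

/-- Vectors with geometrically decaying inner products are nearly orthogonal: the square of the norm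
of a sum grows linearly in the number of terms. -/
theorem norm_sum_sq_le_of_inner_le_geometric {y : ℕ → H} {C q : ℝ} (hq0 : 0 ≤ q) (hq1 : q < 1)
    (hy : ∀ m n, m ≤ n → ‖inner ℂ (y m) (y n)‖ ≤ C * q ^ (n - m)) (N : ℕ) :
    ‖∑ i ∈ Finset.range N, y i‖ ^ 2 ≤ N * (C + 2 * (C * (1 - q)⁻¹)) := by
  induction N with
  | zero => simp
  | succ N ih =>
    have hC : 0 ≤ C := by simpa using (norm_nonneg _).trans (hy 0 0 le_rfl)
    have h1 : ‖y N‖ ^ 2 ≤ C := by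
      have := hy N N le_rfl
      rw [inner_self_eq_norm_sq_to_K] at this
      simpa using this
    have h2 : RCLike.re (inner ℂ (∑ i ∈ Finset.range N, y i) (y N)) ≤ C * (1 - q)⁻¹ := by
      rw [sum_inner]
      calc _ ≤ ‖∑ i ∈ Finset.range N, inner ℂ (y i) (y N)‖ := RCLike.re_le_norm _
        _ ≤ ∑ i ∈ Finset.range N, C * q ^ (N - i) :=
          norm_sum_le_of_le _ fun i hi => hy i N (Finset.mem_range.1 hi).le
        _ ≤ C * (1 - q)⁻¹ := by
          rw [← Finset.mul_sum]
          exact mul_le_mul_of_nonneg_left (sum_pow_sub_le hq0 hq1 N) hC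
    rw [Finset.sum_range_succ, norm_add_sq (𝕜 := ℂ)]
    push_cast
    linarith

theorem tendsto_average_of_inner_le_geometric {y : ℕ → H} {C q : ℝ} (hq0 : 0 ≤ q) (hq1 : q < 1)
    (hy : ∀ m n, m ≤ n → ‖inner ℂ (y m) (y n)‖ ≤ C * q ^ (n - m)) :
    Tendsto (fun N : ℕ => (N : ℂ)⁻¹ • ∑ i ∈ Finset.range N, y i) atTop (𝓝 0) := by
  set K := C + 2 * (C * (1 - q)⁻¹)
  have hK : Tendsto (fun N : ℕ => Real.sqrt (K * (N : ℝ)⁻¹)) atTop (𝓝 0) := by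
    have := ((tendsto_inv_atTop_nhds_zero_nat (𝕜 := ℝ)).const_mul K).sqrt
    simpa using this
  refine squeeze_zero_norm (fun N => ?_) hK
  refine Real.le_sqrt_of_sq_le ?_
  have := norm_sum_sq_le_of_inner_le_geometric hq0 hq1 hy N
  rw [norm_smul, norm_inv, RCLike.norm_natCast, mul_pow]
  rcases N.eq_zero_or_pos with rfl | hN
  · simp
  · have hN' : (0 : ℝ) < N := by exact_mod_cast hN
    calc ((N : ℝ)⁻¹) ^ 2 * ‖∑ i ∈ Finset.range N, y i‖ ^ 2 ≤ ((N : ℝ)⁻¹) ^ 2 * (N * K) := by gcongr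
      _ = K * (N : ℝ)⁻¹ := by field_simp

end Hilbert

section Normed
variable {E : Type*} [NormedAddCommGroup E] [NormedSpace ℂ E]

theorem Filter.Tendsto.average_range {u : ℕ → E} {l : E} (h : Tendsto u atTop (𝓝 l)) :
    Tendsto (fun N : ℕ => (N : ℂ)⁻¹ • ∑ i ∈ Finset.range N, u i) atTop (𝓝 l) := by
  let _ : NormedSpace ℝ E := NormedSpace.restrictScalars ℝ ℂ E
  refine h.cesaro_smul.congr fun N => ?_
  rw [← Complex.coe_smul]
  push_cast
  rfl

/-- A bounded sequence whose shift is asymptotically multiplication by `ω ≠ 1` averages to zero. -/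
theorem tendsto_average_of_tendsto_sub_smul {y : ℕ → E} {R : ℝ} (hy : ∀ n, ‖y n‖ ≤ R) {ω : ℂ}
    (hω : ω ≠ 1) (h : Tendsto (fun n => y (n + 1) - ω • y n) atTop (𝓝 0)) :
    Tendsto (fun N : ℕ => (N : ℂ)⁻¹ • ∑ i ∈ Finset.range N, y i) atTop (𝓝 0) := by
  have h1 := h.average_range
  have h2 : Tendsto (fun N : ℕ => (N : ℂ)⁻¹ • (y N - y 0)) atTop (𝓝 0) := by
    have h3 : Tendsto (fun N : ℕ => (N : ℝ)⁻¹ * (R + R)) atTop (𝓝 0) := by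
      simpa using (tendsto_inv_atTop_nhds_zero_nat (𝕜 := ℝ)).mul_const (R + R)
    refine squeeze_zero_norm (fun N => ?_) h3
    rw [norm_smul, norm_inv, RCLike.norm_natCast]
    gcongr
    exact (norm_sub_le _ _).trans (add_le_add (hy N) (hy 0))
  have h4 := (h1.sub h2).const_smul (1 - ω)⁻¹
  rw [sub_zero, smul_zero] at h4
  refine h4.congr fun N => ?_
  have hne : 1 - ω ≠ 0 := sub_ne_zero.2 hω.symm
  have h5 : ∑ i ∈ Finset.range N, (y (i + 1) - ω • y i) - (y N - y 0) =
      (1 - ω) • ∑ i ∈ Finset.range N, y i := by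
    rw [← Finset.sum_range_sub, Finset.smul_sum, ← Finset.sum_sub_distrib]
    refine Finset.sum_congr rfl fun i _ => ?_
    rw [sub_smul, one_smul]; abel
  rw [← smul_sub, h5, smul_smul, smul_smul, mul_right_comm, inv_mul_cancel₀ hne, one_mul]

/-- If `z` converges and `w` is bounded and averages to zero, then `w n • z n` averages to zero. -/
theorem tendsto_average_smul_of_tendsto {w : ℕ → ℂ} {R : ℝ} (hw1 : ∀ n, ‖w n‖ ≤ R)
    (hw : Tendsto (fun N : ℕ => (N : ℂ)⁻¹ * ∑ i ∈ Finset.range N, w i) atTop (𝓝 0))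
    {z : ℕ → E} {l : E} (hz : Tendsto z atTop (𝓝 l)) :
    Tendsto (fun N : ℕ => (N : ℂ)⁻¹ • ∑ i ∈ Finset.range N, w i • z i) atTop (𝓝 0) := by
  have h1 : Tendsto (fun n => w n • (z n - l)) atTop (𝓝 0) := by
    have h0 : Tendsto (fun n => R * ‖z n - l‖) atTop (𝓝 0) := by
      simpa using (hz.sub_const l).norm.const_mul R
    refine squeeze_zero_norm (fun n => ?_) h0
    rw [norm_smul]
    gcongr
    exact hw1 n
  have h2 := h1.average_range.add (hw.smul_const l)
  rw [zero_smul, add_zero] at h2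
  refine h2.congr fun N => ?_
  rw [mul_smul, Finset.sum_smul, ← smul_add, ← Finset.sum_add_distrib]
  congr 1
  refine Finset.sum_congr rfl fun i _ => ?_
  rw [smul_sub]; abel

end Normed

/-! ### Reduction of ergodicity to powers of the coordinate -/

section Criterion
variable {T : ℕ → Circle → Circle}

theorem sum_Icc_one_eq_sum_range {M : Type*} [AddCommMonoid M] (f : ℕ → M) (N : ℕ) :
    ∑ n ∈ Finset.Icc 1 N, f n = ∑ i ∈ Finset.range N, f (i + 1) := by
  rw [Finset.range_eq_Ico, Finset.sum_Ico_add' f 0 N 1]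
  rfl

/-- Averaging along measure-preserving maps is bounded on `L²`, uniformly in `N`. -/
theorem eLpNorm_average_sub_integral_le (hT : ∀ n, 1 ≤ n → AEMeasurable (T n) circleMeasure)
    (hmap : ∀ n, 1 ≤ n → circleMeasure.map (T n) = circleMeasure) {ψ : Circle → ℂ}
    (hψ : MemLp ψ 2 circleMeasure) (N : ℕ) :
    eLpNorm (fun x => (N : ℂ)⁻¹ * ∑ n ∈ Finset.Icc 1 N, ψ (T n x) - ∫ y, ψ y ∂circleMeasure) 2
      circleMeasure ≤ 2 * eLpNorm ψ 2 circleMeasure := by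
  have hcomp : ∀ n ∈ Finset.Icc 1 N, AEStronglyMeasurable (fun x => ψ (T n x)) circleMeasure := by
    intro n hn
    have hn1 := (Finset.mem_Icc.1 hn).1
    refine AEStronglyMeasurable.comp_aemeasurable ?_ (hT n hn1)
    rw [hmap n hn1]; exact hψ.1
  have hnorm : ∀ n ∈ Finset.Icc 1 N,
      eLpNorm (fun x => ψ (T n x)) 2 circleMeasure = eLpNorm ψ 2 circleMeasure := by
    intro n hn
    have hn1 := (Finset.mem_Icc.1 hn).1
    have := eLpNorm_map_measure (p := 2) (g := ψ) (f := T n) (μ := circleMeasure)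
      (by rw [hmap n hn1]; exact hψ.1) (hT n hn1)
    rw [hmap n hn1] at this
    exact this.symm
  have h1 : eLpNorm (fun x => (N : ℂ)⁻¹ * ∑ n ∈ Finset.Icc 1 N, ψ (T n x)) 2 circleMeasure ≤
      eLpNorm ψ 2 circleMeasure := by
    have h2 : (fun x => (N : ℂ)⁻¹ * ∑ n ∈ Finset.Icc 1 N, ψ (T n x)) =
        (N : ℂ)⁻¹ • ∑ n ∈ Finset.Icc 1 N, fun x => ψ (T n x) := by
      ext x; simp
    rw [h2, eLpNorm_const_smul]
    calc _ ≤ ‖(N : ℂ)⁻¹‖ₑ * ∑ n ∈ Finset.Icc 1 N, eLpNorm (fun x => ψ (T n x)) 2 circleMeasure := by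
          gcongr
          exact eLpNorm_sum_le hcomp (by norm_num)
      _ = ‖(N : ℂ)⁻¹‖ₑ * (N * eLpNorm ψ 2 circleMeasure) := by
          rw [Finset.sum_congr rfl hnorm]; simp
      _ ≤ eLpNorm ψ 2 circleMeasure := by
          rcases N.eq_zero_or_pos with rfl | hN
          · simp
          · rw [← mul_assoc, enorm_inv (by exact_mod_cast hN.ne')]
            have : ‖(N : ℂ)‖ₑ = N := by simp [enorm_eq_nnnorm]
            rw [this, ENNReal.inv_mul_cancel (by exact_mod_cast hN.ne') (by simp), one_mul]
  have h3 : eLpNorm (fun _ : Circle => ∫ y, ψ y ∂circleMeasure) 2 circleMeasure ≤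
      eLpNorm ψ 2 circleMeasure := by
    rw [eLpNorm_const _ (by norm_num) (IsProbabilityMeasure.ne_zero _)]
    simp only [measure_univ, ENNReal.one_rpow, mul_one]
    refine (enorm_integral_le_lintegral_enorm _).trans ?_
    rw [← eLpNorm_one_eq_lintegral_enorm]
    exact eLpNorm_le_eLpNorm_of_exponent_le (by norm_num) hψ.1
  have h4 : AEStronglyMeasurable (fun x => (N : ℂ)⁻¹ * ∑ n ∈ Finset.Icc 1 N, ψ (T n x))
      circleMeasure :=
    (Finset.aestronglyMeasurable_fun_sum _ hcomp).const_mul _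
  refine (eLpNorm_sub_le h4 aestronglyMeasurable_const (by norm_num)).trans ?_
  rw [two_mul]
  exact add_le_add h1 h3

theorem integral_circleZPow {n : ℤ} (hn : n ≠ 0) :
    ∫ ζ : Circle, (ζ : ℂ) ^ n ∂circleMeasure = 0 := by
  obtain ⟨j, rfl | rfl⟩ := n.eq_nat_or_neg
  · simpa [boundaryMap_id] using
      isInnerFunction_id.integral_boundaryMap_pow rfl (j := j) (by simpa using hn)
  · simpa [boundaryMap_id] using
      isInnerFunction_id.integral_boundaryMap_inv_pow rfl (j := j) (by simpa using hn)

/-- Ergodicity need only be tested on the functions `ζ ↦ ζ ^ k`, `k ≥ 1`. -/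
theorem isErgodicSeq_of_tendsto_pow (hT : ∀ n, 1 ≤ n → AEMeasurable (T n) circleMeasure)
    (hmap : ∀ n, 1 ≤ n → circleMeasure.map (T n) = circleMeasure)
    (h : ∀ k : ℕ, 1 ≤ k → Tendsto (fun N : ℕ => eLpNorm
      (fun x => (N : ℂ)⁻¹ * ∑ n ∈ Finset.Icc 1 N, (T n x : ℂ) ^ k) 2 circleMeasure)
        atTop (𝓝 0)) :
    IsErgodicSeq circleMeasure T := by
  refine ⟨hT, hmap, ?_⟩
  -- the error of the `N`-th average
  set A : (Circle → ℂ) → ℕ → Circle → ℂ := fun φ N x =>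
    (N : ℂ)⁻¹ * ∑ n ∈ Finset.Icc 1 N, φ (T n x) - ∫ y, φ y ∂circleMeasure with hA
  have hmon : ∀ n : ℤ, Tendsto (fun N => eLpNorm (A (circleZPow n) N) 2 circleMeasure)
      atTop (𝓝 0) := by
    intro n
    rcases eq_or_ne n 0 with rfl | hn
    · refine tendsto_const_nhds.congr' ?_
      filter_upwards [eventually_ge_atTop 1] with N hN
      have : A (circleZPow 0) N = 0 := by
        ext x
        have hN' : (N : ℂ) ≠ 0 := by exact_mod_cast (by omega : N ≠ 0)
        simp [hA, circleZPow_apply, hN']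
      rw [this, eLpNorm_zero]
    obtain ⟨j, rfl | rfl⟩ := n.eq_nat_or_neg
    · refine (h j (by omega)).congr fun N => ?_
      congr 1
      ext x
      simp only [hA, circleZPow_apply]
      rw [integral_circleZPow hn]
      simp
    · refine (h j (by omega)).congr fun N => ?_
      refine eLpNorm_congr_norm_ae (Eventually.of_forall fun x => ?_)
      simp only [hA, circleZPow_apply]
      rw [integral_circleZPow hn, sub_zero, ← RCLike.norm_conj]
      congr 1
      simp only [map_mul, map_sum, map_inv₀, map_natCast, map_pow, zpow_neg, zpow_natCast,
        ← Circle.coe_inv_eq_conj, Circle.coe_inv, inv_pow]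
  have hcont : ∀ q : C(Circle, ℂ), Integrable q circleMeasure := fun q =>
    q.continuous.integrable_of_hasCompactSupport (HasCompactSupport.of_compactSpace _)
  have hAm : ∀ (q : C(Circle, ℂ)) N, AEStronglyMeasurable (A q N) circleMeasure := by
    intro q N
    refine ((Finset.aestronglyMeasurable_fun_sum _ fun n hn => ?_).const_mul _).sub
      aestronglyMeasurable_const
    exact (q.continuous.measurable.comp_aemeasurable
      (hT n (Finset.mem_Icc.1 hn).1)).aestronglyMeasurable
  have hspan : ∀ q ∈ Submodule.span ℂ (Set.range circleZPow),
      Tendsto (fun N => eLpNorm (A q N) 2 circleMeasure) atTop (𝓝 0) := by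
    intro q hq
    induction hq using Submodule.span_induction with
    | mem q hq =>
      obtain ⟨n, rfl⟩ := hq
      exact hmon n
    | zero =>
      refine tendsto_const_nhds.congr fun N => ?_
      have : A (0 : C(Circle, ℂ)) N = 0 := by ext x; simp [hA]
      rw [this, eLpNorm_zero]
    | add p q _ _ hp hq =>
      have hpq := hp.add hq
      rw [add_zero] at hpq
      refine tendsto_of_tendsto_of_tendsto_of_le_of_le tendsto_const_nhds hpq
        (fun _ => zero_le) fun N => ?_
      have : A (p + q : C(Circle, ℂ)) N = A p N + A q N := by
        ext x
        simp only [hA, ContinuousMap.add_apply, Pi.add_apply]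
        rw [integral_add (hcont p) (hcont q), Finset.sum_add_distrib]
        ring
      rw [this]
      exact eLpNorm_add_le (hAm p N) (hAm q N) (by norm_num)
    | smul c q _ hq =>
      have hcq := ENNReal.Tendsto.const_mul (a := ‖c‖ₑ) hq (Or.inr (by simp))
      rw [mul_zero] at hcq
      refine hcq.congr fun N => ?_
      have : A (c • q : C(Circle, ℂ)) N = c • A q N := by
        ext x
        simp only [hA, ContinuousMap.smul_apply, Pi.smul_apply, smul_eq_mul]
        rw [integral_const_mul, ← Finset.mul_sum]
        ring
      rw [this, eLpNorm_const_smul]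
  intro φ hφ
  refine ENNReal.tendsto_nhds_zero.2 fun ε hε => ?_
  have hε3 : ε / 4 ≠ 0 := (ENNReal.div_pos hε.ne' (by norm_num)).ne'
  obtain ⟨q, hq, hφq⟩ := exists_trigPolynomial_eLpNorm_sub_le one_le_two (by norm_num) hφ hε3
  filter_upwards [ENNReal.tendsto_nhds_zero.1 (hspan q hq) (ε / 2)
    (ENNReal.half_pos hε.ne')] with N hN
  have hq2 : MemLp q 2 circleMeasure :=
    MemLp.of_bound q.continuous.aestronglyMeasurable ‖q‖
      (Eventually.of_forall fun ζ => q.norm_coe_le_norm ζ)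
  have hsub : MemLp (fun ζ => φ ζ - q ζ) 2 circleMeasure := hφ.sub hq2
  have hle := eLpNorm_average_sub_integral_le hT hmap hsub N
  have hdec : A φ N = A (fun ζ => φ ζ - q ζ) N + A q N := by
    ext x
    simp only [hA, Pi.add_apply]
    rw [integral_sub (hφ.integrable one_le_two) (hcont q), Finset.sum_sub_distrib]
    ring
  change eLpNorm (A φ N) 2 circleMeasure ≤ ε
  have hm : AEStronglyMeasurable (A (fun ζ => φ ζ - q ζ) N) circleMeasure := by
    refine ((Finset.aestronglyMeasurable_fun_sum _ fun n hn => ?_).const_mul _).sub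
      aestronglyMeasurable_const
    have hn1 := (Finset.mem_Icc.1 hn).1
    refine AEStronglyMeasurable.comp_aemeasurable (g := fun ζ => φ ζ - q ζ) ?_ (hT n hn1)
    rw [hmap n hn1]; exact hsub.1
  rw [hdec]
  refine (eLpNorm_add_le hm (hAm q N) one_le_two).trans ?_
  calc _ ≤ 2 * (ε / 4) + ε / 2 := add_le_add (hle.trans (by gcongr)) hN
    _ = ε := by
      have : 2 * (ε / 4) = ε / 2 := by
        rw [div_eq_mul_inv, div_eq_mul_inv, mul_left_comm]
        congr 1
        rw [show (4 : ENNReal) = 2 * 2 by norm_num, ENNReal.mul_inv (by simp) (by simp),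
          ← mul_assoc,
          ENNReal.mul_inv_cancel (by simp) (by simp), one_mul]
      rw [this, ENNReal.add_halves]

end Criterion

/-! ### Powers of circle-valued maps as vectors in `L²` -/

section CirclePowL2
variable {X : Type*} [MeasurableSpace X] {μ : Measure X} [IsProbabilityMeasure μ]

theorem memLp_circle_pow {T : X → Circle} (hT : AEMeasurable T μ) (k : ℕ) :
    MemLp (fun x => (T x : ℂ) ^ k) 2 μ := by
  refine MemLp.of_bound (C := 1) ?_ (Eventually.of_forall fun x => ?_)
  · exact ((continuous_circle_coe.pow k).measurable.comp_aemeasurable hT).aestronglyMeasurable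
  · rw [norm_pow, Circle.norm_coe, one_pow]

/-- The `k`-th power of a circle-valued map, as a vector in `L²`. -/
noncomputable def circlePowL2 {T : X → Circle} (hT : AEMeasurable T μ) (k : ℕ) : Lp ℂ 2 μ :=
  (memLp_circle_pow hT k).toLp _

theorem coeFn_circlePowL2 {T : X → Circle} (hT : AEMeasurable T μ) (k : ℕ) :
    circlePowL2 hT k =ᵐ[μ] fun x => (T x : ℂ) ^ k :=
  MemLp.coeFn_toLp _

theorem inner_circlePowL2 {S T : X → Circle} (hS : AEMeasurable S μ) (hT : AEMeasurable T μ)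
    (k : ℕ) : inner ℂ (circlePowL2 hS k) (circlePowL2 hT k) =
      ∫ x, (T x : ℂ) ^ k * ((S x : ℂ)⁻¹) ^ k ∂μ := by
  rw [L2.inner_def]
  refine integral_congr_ae ?_
  filter_upwards [coeFn_circlePowL2 hS k, coeFn_circlePowL2 hT k] with x h1 h2
  rw [h1, h2, RCLike.inner_apply, map_pow, ← Circle.coe_inv_eq_conj, Circle.coe_inv]

theorem norm_circlePowL2 {T : X → Circle} (hT : AEMeasurable T μ) (k : ℕ) :
    ‖circlePowL2 hT k‖ = 1 := by
  have h := inner_circlePowL2 hT hT k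
  simp only [← mul_pow, mul_inv_cancel₀ (Circle.coe_ne_zero _), one_pow, integral_const,
    probReal_univ, one_smul] at h
  have h2 : ‖circlePowL2 hT k‖ ^ 2 = 1 := by
    rw [norm_sq_eq_re_inner (𝕜 := ℂ), h, RCLike.one_re]
  exact (pow_eq_one_iff_of_nonneg (norm_nonneg _) two_ne_zero).1 h2

theorem enorm_smul_sum_circlePowL2 {ι : Type*} {T : ι → X → Circle}
    (hT : ∀ i, AEMeasurable (T i) μ) (k : ℕ) (c : ℂ) (s : Finset ι) :
    ‖c • ∑ i ∈ s, circlePowL2 (hT i) k‖ₑ =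
      eLpNorm (fun x => c * ∑ i ∈ s, (T i x : ℂ) ^ k) 2 μ := by
  rw [Lp.enorm_def]
  refine eLpNorm_congr_ae ?_
  have h1 : ∀ᵐ x ∂μ, ∀ i ∈ s, circlePowL2 (hT i) k x = (T i x : ℂ) ^ k :=
    (Finset.eventually_all s).2 fun i _ => coeFn_circlePowL2 (hT i) k
  filter_upwards [Lp.coeFn_smul c (∑ i ∈ s, circlePowL2 (hT i) k),
    Lp.coeFn_finsetSum s fun i => circlePowL2 (hT i) k, h1] with x h2 h3 h4
  rw [h2, Pi.smul_apply, h3, Finset.sum_apply, Finset.sum_congr rfl h4, smul_eq_mul]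

end CirclePowL2

section compSeq
variable {g : ℕ → ℂ → ℂ}

theorem aemeasurable_boundaryMap_compSeq
    (hg : ∀ n, 1 ≤ n → IsInnerFunction (g n) ∧ g n 0 = 0) (n : ℕ) :
    AEMeasurable (boundaryMap (compSeq g n)) circleMeasure :=
  (isInnerFunction_compSeq hg n).1.aemeasurable_boundaryMap

/-- The `k`-th power of the boundary map of `g n ∘ ⋯ ∘ g 1`, as a vector in `L²`. -/
noncomputable def boundaryPow (hg : ∀ n, 1 ≤ n → IsInnerFunction (g n) ∧ g n 0 = 0) (k n : ℕ) :
    Lp ℂ 2 circleMeasure :=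
  circlePowL2 (aemeasurable_boundaryMap_compSeq hg n) k

theorem inner_boundaryPow (hg : ∀ n, 1 ≤ n → IsInnerFunction (g n) ∧ g n 0 = 0) (k : ℕ) {m n : ℕ}
    (hmn : m ≤ n) : inner ℂ (boundaryPow hg k m) (boundaryPow hg k n) =
      (∏ j ∈ Finset.Ioc m n, deriv (g j) 0) ^ k := by
  rw [boundaryPow, boundaryPow, inner_circlePowL2, integral_boundaryMap_compSeq hg hmn]

theorem norm_boundaryPow (hg : ∀ n, 1 ≤ n → IsInnerFunction (g n) ∧ g n 0 = 0) (k n : ℕ) :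
    ‖boundaryPow hg k n‖ = 1 :=
  norm_circlePowL2 _ k

theorem norm_deriv_le_one (hg : ∀ n, 1 ≤ n → IsInnerFunction (g n) ∧ g n 0 = 0) {n : ℕ}
    (hn : 1 ≤ n) : ‖deriv (g n) 0‖ ≤ 1 := by
  obtain ⟨h1, h2⟩ := hg n hn
  refine Complex.norm_deriv_le_one_of_mapsTo_ball h1.differentiableOn ?_ one_pos
  rw [h2]
  exact h1.mapsTo.mono_right Metric.ball_subset_closedBall

theorem norm_prod_deriv_le_one (hg : ∀ n, 1 ≤ n → IsInnerFunction (g n) ∧ g n 0 = 0) (m n : ℕ) :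
    ‖∏ j ∈ Finset.Ioc m n, deriv (g j) 0‖ ≤ 1 := by
  rw [norm_prod]
  refine Finset.prod_le_one (fun _ _ => norm_nonneg _) fun j hj => norm_deriv_le_one hg ?_
  have := (Finset.mem_Ioc.1 hj).1
  omega

theorem isErgodicSeq_boundaryMap_compSeq
    (hg : ∀ n, 1 ≤ n → IsInnerFunction (g n) ∧ g n 0 = 0) (s : ℕ → ℕ)
    (h : ∀ k : ℕ, 1 ≤ k → Tendsto (fun N : ℕ =>
      (N : ℂ)⁻¹ • ∑ i ∈ Finset.range N, boundaryPow hg k (s (i + 1))) atTop (𝓝 0)) :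
    IsErgodicSeq circleMeasure (fun n => boundaryMap (compSeq g (s n))) := by
  refine isErgodicSeq_of_tendsto_pow (fun n _ => aemeasurable_boundaryMap_compSeq hg (s n))
    (fun n _ => (isInnerFunction_compSeq hg (s n)).1.map_boundaryMap
      (isInnerFunction_compSeq hg (s n)).2) fun k hk => ?_
  have h1 := (h k hk).enorm
  rw [enorm_zero] at h1
  refine h1.congr fun N => ?_
  simp only [boundaryPow]
  rw [enorm_smul_sum_circlePowL2 (T := fun i => boundaryMap (compSeq g (s (i + 1))))]
  simp only [sum_Icc_one_eq_sum_range]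

/-! ### Mixing -/

/-- Geometric decay of the derivatives of the intermediate compositions at the origin passes to
subsequences, so it gives mixing. -/
theorem isMixingSeq_of_geometric (hg : ∀ n, 1 ≤ n → IsInnerFunction (g n) ∧ g n 0 = 0) {s : ℕ → ℕ}
    (hs : Monotone s) {C q : ℝ} (hq0 : 0 ≤ q) (hq1 : q < 1)
    (h : ∀ m n, m ≤ n → ‖∏ j ∈ Finset.Ioc (s m) (s n), deriv (g j) 0‖ ≤ C * q ^ (n - m)) :
    IsMixingSeq circleMeasure (fun n => boundaryMap (compSeq g (s n))) := by
  intro t ht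
  refine isErgodicSeq_boundaryMap_compSeq hg (fun n => s (t n)) fun k hk => ?_
  refine tendsto_average_of_inner_le_geometric (C := C) hq0 hq1 fun m n hmn => ?_
  have hC : 0 ≤ C := by simpa using (norm_nonneg _).trans (h 0 0 le_rfl)
  have hmn' : t (m + 1) ≤ t (n + 1) := ht.monotone (by omega)
  rw [inner_boundaryPow hg k (hs hmn'), norm_pow]
  calc ‖∏ j ∈ Finset.Ioc (s (t (m + 1))) (s (t (n + 1))), deriv (g j) 0‖ ^ k
      ≤ ‖∏ j ∈ Finset.Ioc (s (t (m + 1))) (s (t (n + 1))), deriv (g j) 0‖ :=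
        pow_le_of_le_one (norm_nonneg _) (norm_prod_deriv_le_one hg _ _) (by omega)
    _ ≤ C * q ^ (t (n + 1) - t (m + 1)) := h _ _ hmn'
    _ ≤ C * q ^ (n - m) := by
      refine mul_le_mul_of_nonneg_left (pow_le_pow_of_le_one hq0 hq1.le ?_) hC
      have := ht.add_le_nat (n - m) (m + 1)
      rw [show n - m + (m + 1) = n + 1 by omega] at this
      omega

theorem norm_prod_deriv_le_exp {m n : ℕ} (hmn : m ≤ n) : ‖∏ j ∈ Finset.Ioc m n, deriv (g j) 0‖ ≤
      Real.exp (∑ i ∈ Finset.range m, (1 - ‖deriv (g (i + 1)) 0‖) -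
        ∑ i ∈ Finset.range n, (1 - ‖deriv (g (i + 1)) 0‖)) := by
  induction n, hmn using Nat.le_induction with
  | base => simp
  | succ n hmn ih =>
    rw [Finset.prod_Ioc_succ_top (by omega), norm_mul, Finset.sum_range_succ, ← sub_sub,
      sub_eq_add_neg _ (1 - _), Real.exp_add]
    refine mul_le_mul ih ?_ (norm_nonneg _) (Real.exp_nonneg _)
    have := Real.add_one_le_exp (-(1 - ‖deriv (g (n + 1)) 0‖))
    linarith

theorem exists_isMixingSeq_of_not_summable
    (hg : ∀ n, 1 ≤ n → IsInnerFunction (g n) ∧ g n 0 = 0)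
    (h : ¬ Summable fun n : ℕ => 1 - ‖deriv (g (n + 1)) 0‖) :
    ∃ s : ℕ → ℕ, StrictMono s ∧
      IsMixingSeq circleMeasure (fun k => boundaryMap (compSeq g (s k))) := by
  have hnn : ∀ n : ℕ, 0 ≤ 1 - ‖deriv (g (n + 1)) 0‖ := fun n =>
    sub_nonneg.2 (norm_deriv_le_one hg (by omega))
  rw [not_summable_iff_tendsto_nat_atTop_of_nonneg hnn] at h
  -- from each index on, the products of derivatives tend to zero, so they can be halved
  have hstep : ∀ m : ℕ, ∃ n, m < n ∧ ‖∏ j ∈ Finset.Ioc m n, deriv (g j) 0‖ ≤ 1 / 2 := by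
    intro m
    obtain ⟨n, hn, hmn⟩ := ((h.eventually_ge_atTop
      (∑ i ∈ Finset.range m, (1 - ‖deriv (g (i + 1)) 0‖) + 1)).and (eventually_gt_atTop m)).exists
    refine ⟨n, hmn, (norm_prod_deriv_le_exp hmn.le).trans ?_⟩
    calc Real.exp _ ≤ Real.exp (-1) := Real.exp_le_exp.2 (by linarith)
      _ ≤ 1 / 2 := by
        rw [Real.exp_neg, one_div]
        exact inv_anti₀ two_pos (by linarith [Real.add_one_le_exp (1 : ℝ)])
  choose next hlt hnext using hstep
  let s : ℕ → ℕ := fun k => next^[k] 0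
  have hs1 : ∀ k, s (k + 1) = next (s k) := fun k => Function.iterate_succ_apply' next k 0
  have hs : StrictMono s := strictMono_nat_of_lt_succ fun k => by rw [hs1]; exact hlt _
  refine ⟨s, hs, isMixingSeq_of_geometric hg hs.monotone (C := 1) (q := 1 / 2) (by norm_num)
    (by norm_num) fun m n hmn => ?_⟩
  rw [one_mul]
  induction n, hmn using Nat.le_induction with
  | base => simp
  | succ n hmn ih =>
    rw [← Finset.prod_Ioc_consecutive _ (hs.monotone hmn) (hs.monotone n.le_succ), norm_mul,
      show n + 1 - m = n - m + 1 by omega, pow_succ]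
    refine mul_le_mul ih ?_ (norm_nonneg _) (by positivity)
    rw [hs1]
    exact hnext _

theorem norm_prod_deriv_le_pow_card (hg : ∀ n, 1 ≤ n → IsInnerFunction (g n) ∧ g n 0 = 0)
    (lam : ℝ) (m n : ℕ) : ‖∏ j ∈ Finset.Ioc m n, deriv (g j) 0‖ ≤
      lam ^ ({j : ℕ | j ∈ Set.Icc (m + 1) n ∧ ‖deriv (g j) 0‖ ≤ lam}.ncard) := by
  have hset : {j : ℕ | j ∈ Set.Icc (m + 1) n ∧ ‖deriv (g j) 0‖ ≤ lam} =
      ((Finset.Ioc m n).filter fun j => ‖deriv (g j) 0‖ ≤ lam : Finset ℕ) := by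
    ext j; simp
  rw [hset, Set.ncard_coe_finset, norm_prod,
    ← Finset.prod_filter_mul_prod_filter_not _ fun j => ‖deriv (g j) 0‖ ≤ lam]
  have h1 : ∏ j ∈ (Finset.Ioc m n).filter (fun j => ‖deriv (g j) 0‖ ≤ lam), ‖deriv (g j) 0‖ ≤
      lam ^ ((Finset.Ioc m n).filter fun j => ‖deriv (g j) 0‖ ≤ lam).card := by
    rw [← Finset.prod_const]
    exact Finset.prod_le_prod (fun _ _ => norm_nonneg _) fun j hj => (Finset.mem_filter.1 hj).2
  have h2 : ∏ j ∈ (Finset.Ioc m n).filter (fun j => ¬ ‖deriv (g j) 0‖ ≤ lam), ‖deriv (g j) 0‖ ≤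
      1 := by
    refine Finset.prod_le_one (fun _ _ => norm_nonneg _) fun j hj => norm_deriv_le_one hg ?_
    have := (Finset.mem_Ioc.1 (Finset.mem_filter.1 hj).1).1
    omega
  exact (mul_le_of_le_one_right (Finset.prod_nonneg fun _ _ => norm_nonneg _) h2).trans h1

/-- The proportion of factors of modulus at most `lam` gives decay at the rate `lam ^ c`. -/
theorem isMixingSeq_of_density (hg : ∀ n, 1 ≤ n → IsInnerFunction (g n) ∧ g n 0 = 0)
    {lam c M₀ : ℝ} (hl0 : 0 < lam) (hl1 : lam < 1) (hc0 : 0 < c)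
    (h : ∀ a b : ℕ, 1 ≤ a → M₀ < (b : ℝ) - (a : ℝ) → c * ((b : ℝ) - (a : ℝ)) ≤
      (({n : ℕ | n ∈ Set.Icc a b ∧ ‖deriv (g n) 0‖ ≤ lam}.ncard : ℕ) : ℝ)) :
    IsMixingSeq circleMeasure (fun n => boundaryMap (compSeq g n)) := by
  set q : ℝ := lam ^ c with hq
  have hq0 : 0 < q := Real.rpow_pos_of_pos hl0 c
  have hq1 : q < 1 := Real.rpow_lt_one hl0.le hl1 hc0
  obtain ⟨L, hL⟩ := exists_nat_gt M₀
  -- the constant absorbs the short intervals, on which nothing is assumed, and the off-by-one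
  -- between `Icc (m + 1) n`, of length `n - m - 1`, and the exponent `n - m`
  refine isMixingSeq_of_geometric hg monotone_id (C := (q ^ (L + 1))⁻¹) hq0.le hq1 fun m n hmn => ?_
  rw [inv_mul_eq_div, le_div_iff₀ (by positivity)]
  rcases le_or_gt (n - m) (L + 1) with hle | hgt
  · have h1 := norm_prod_deriv_le_one hg m n
    have h2 : q ^ (L + 1) ≤ q ^ (n - m) := pow_le_pow_of_le_one hq0.le hq1.le hle
    nlinarith [pow_pos hq0 (L + 1)]
  · obtain ⟨d, rfl⟩ : ∃ d, n = m + 1 + d := ⟨n - (m + 1), by omega⟩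
    have hd : ((m + 1 + d : ℕ) : ℝ) - ((m + 1 : ℕ) : ℝ) = d := by push_cast; ring
    have hdL : (L : ℝ) < d := by exact_mod_cast (by omega : L < d)
    have h1 := h (m + 1) (m + 1 + d) (by omega) (by rw [hd]; linarith)
    rw [hd] at h1
    have h2 : ‖∏ j ∈ Finset.Ioc m (m + 1 + d), deriv (g j) 0‖ ≤ q ^ d := by
      refine (norm_prod_deriv_le_pow_card hg lam m (m + 1 + d)).trans ?_
      rw [hq, ← Real.rpow_natCast, ← Real.rpow_natCast, ← Real.rpow_mul hl0.le]
      exact Real.rpow_le_rpow_of_exponent_ge hl0 hl1.le h1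
    calc _ ≤ q ^ d * q ^ 1 := mul_le_mul h2 (pow_le_pow_of_le_one hq0.le hq1.le (by omega))
          (by positivity) (by positivity)
      _ = q ^ (m + 1 + d - m) := by rw [← pow_add]; congr 1; omega

/-! ### Ergodicity for convergent arguments -/

theorem tendsto_norm_deriv_of_summable (h : Summable fun n : ℕ => 1 - ‖deriv (g (n + 1)) 0‖) :
    Tendsto (fun n => ‖deriv (g n) 0‖) atTop (𝓝 1) := by
  have h1 := h.tendsto_atTop_zero.const_sub 1
  simp only [sub_sub_cancel, sub_zero] at h1
  exact (tendsto_add_atTop_iff_nat 1).1 h1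

/-- Consecutive boundary maps are asymptotically related by an irrational rotation. -/
theorem isErgodicSeq_of_tendsto_arg (hg : ∀ n, 1 ≤ n → IsInnerFunction (g n) ∧ g n 0 = 0)
    (h : Summable fun n : ℕ => 1 - ‖deriv (g (n + 1)) 0‖) {θ : ℝ} (hθ : Irrational θ)
    (harg : Tendsto (fun n : ℕ => ((Complex.arg (deriv (g n) 0) : ℝ) : Real.Angle)) atTop
      (𝓝 ((2 * Real.pi * θ : ℝ) : Real.Angle))) :
    IsErgodicSeq circleMeasure (fun n => boundaryMap (compSeq g n)) := by
  refine isErgodicSeq_boundaryMap_compSeq hg id fun k hk => ?_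
  set e : ℂ := Complex.exp ((2 * Real.pi * θ : ℝ) * Complex.I) with he
  have hderiv : Tendsto (fun n => deriv (g n) 0) atTop (𝓝 e) := by
    have hc : Continuous fun α : Real.Angle => (α.toCircle : ℂ) :=
      continuous_circle_coe.comp AddCircle.homeomorphCircle'.continuous
    have h1 := (Complex.continuous_ofReal.tendsto 1).comp (tendsto_norm_deriv_of_summable h)
    have h2 := h1.mul ((hc.tendsto _).comp harg)
    simp only [Real.Angle.toCircle_coe, Circle.coe_exp, Complex.ofReal_one, one_mul] at h2
    refine h2.congr fun n => ?_
    simp only [Function.comp, Real.Angle.toCircle_coe, Circle.coe_exp]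
    exact Complex.norm_mul_exp_arg_mul_I _
  have he1 : ‖e ^ k‖ = 1 := by rw [norm_pow, he, Complex.norm_exp_ofReal_mul_I, one_pow]
  have hek : e ^ k ≠ 1 := by
    rw [he, ← Complex.exp_nat_mul, Ne, Complex.exp_eq_one_iff]
    rintro ⟨n, hn⟩
    have h3 : (k : ℂ) * θ = n := by
      have : ((k : ℂ) * θ) * (2 * Real.pi * Complex.I) = n * (2 * Real.pi * Complex.I) := by
        rw [← hn]; push_cast; ring
      exact mul_right_cancel₀ Complex.two_pi_I_ne_zero this
    have h4 : (k : ℝ) * θ = n := by exact_mod_cast h3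
    exact (hθ.natCast_mul (by omega : k ≠ 0)).ne_int n h4
  refine tendsto_average_of_tendsto_sub_smul (R := 1)
    (fun n => (norm_boundaryPow hg k _).le) hek ?_
  -- the squared distance is an explicit function of `(g (n + 2))' 0`
  have hsq : ∀ n : ℕ, ‖boundaryPow hg k (n + 1 + 1) - e ^ k • boundaryPow hg k (n + 1)‖ ^ 2 =
      2 - 2 * (e ^ k * (starRingEnd ℂ) (deriv (g (n + 2)) 0 ^ k)).re := by
    intro n
    have hin : inner ℂ (boundaryPow hg k (n + 1 + 1)) (boundaryPow hg k (n + 1)) =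
        (starRingEnd ℂ) (deriv (g (n + 2)) 0 ^ k) := by
      rw [← inner_conj_symm, inner_boundaryPow hg k (Nat.le_succ (n + 1))]
      simp
    rw [norm_sub_sq (𝕜 := ℂ), inner_smul_right, hin, norm_smul, he1, norm_boundaryPow,
      norm_boundaryPow]
    simp only [RCLike.re_to_complex]
    ring
  have hlim : Tendsto (fun n : ℕ =>
      2 - 2 * (e ^ k * (starRingEnd ℂ) (deriv (g (n + 2)) 0 ^ k)).re) atTop (𝓝 0) := by
    have h5 : Tendsto (fun n => deriv (g (n + 2)) 0 ^ k) atTop (𝓝 (e ^ k)) :=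
      ((tendsto_add_atTop_iff_nat 2).2 hderiv).pow k
    have h6 := ((Complex.continuous_re.tendsto _).comp
      (((Complex.continuous_conj.tendsto _).comp h5).const_mul (e ^ k))).const_mul 2 |>.const_sub 2
    convert! h6 using 2
    rw [Complex.mul_conj, Complex.normSq_eq_norm_sq, he1]
    simp
  rw [tendsto_zero_iff_norm_tendsto_zero]
  have h7 := hlim.sqrt
  rw [Real.sqrt_zero] at h7
  refine h7.congr fun n => ?_
  rw [← hsq, Real.sqrt_sq (norm_nonneg _)]
  rfl

end compSeq

/-! ### Random walks on the circle -/

/-- Averages of a bounded sequence need only be controlled along the squares, since consecutive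
squares have ratio tending to one. -/
theorem tendsto_average_of_tendsto_average_sq {w : ℕ → ℂ} (hw1 : ∀ n, ‖w n‖ ≤ 1)
    (h : Tendsto (fun l : ℕ => ((l ^ 2 : ℕ) : ℂ)⁻¹ * ∑ i ∈ Finset.range (l ^ 2), w i)
      atTop (𝓝 0)) :
    Tendsto (fun N : ℕ => (N : ℂ)⁻¹ * ∑ i ∈ Finset.range N, w i) atTop (𝓝 0) := by
  have hsqrt : Tendsto Nat.sqrt atTop atTop :=
    tendsto_atTop_mono' _ (Eventually.of_forall fun _ => le_rfl)
      (tendsto_atTop_atTop.2 fun b => ⟨b ^ 2, fun a ha => Nat.le_sqrt'.2 ha⟩)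
  have hb : Tendsto (fun l : ℕ =>
      ‖((l ^ 2 : ℕ) : ℂ)⁻¹ * ∑ i ∈ Finset.range (l ^ 2), w i‖ + 2 * (l : ℝ)⁻¹) atTop (𝓝 0) := by
    have := h.norm.add ((tendsto_inv_atTop_nhds_zero_nat (𝕜 := ℝ)).const_mul 2)
    simpa using this
  refine squeeze_zero_norm' ?_ (hb.comp hsqrt)
  filter_upwards [eventually_ge_atTop 1] with N hN
  set l := Nat.sqrt N with hl
  have hl1 : 1 ≤ l := Nat.le_sqrt'.2 (by simpa using hN)
  have hle : l ^ 2 ≤ N := Nat.sqrt_le' N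
  have hlt : N < (l + 1) ^ 2 := Nat.lt_succ_sqrt' N
  have hl0 : (0 : ℝ) < l := by exact_mod_cast hl1
  have hleR : (l : ℝ) ^ 2 ≤ N := by exact_mod_cast hle
  have hsplit : ‖∑ i ∈ Finset.range N, w i‖ ≤ ‖∑ i ∈ Finset.range (l ^ 2), w i‖ + 2 * l := by
    rw [← Finset.sum_range_add_sum_Ico _ hle]
    refine (norm_add_le _ _).trans (add_le_add le_rfl ?_)
    refine (norm_sum_le_of_le _ fun i _ => hw1 i).trans ?_
    simp only [Finset.sum_const, Nat.card_Ico, nsmul_eq_mul, mul_one]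
    have : N - l ^ 2 ≤ 2 * l := by
      have : (l + 1) ^ 2 = l ^ 2 + 2 * l + 1 := by ring
      omega
    exact_mod_cast this
  simp only [Function.comp]
  rw [norm_mul, norm_mul, norm_inv, norm_inv, RCLike.norm_natCast, RCLike.norm_natCast]
  push_cast
  calc (N : ℝ)⁻¹ * ‖∑ i ∈ Finset.range N, w i‖
      ≤ ((l : ℝ) ^ 2)⁻¹ * (‖∑ i ∈ Finset.range (l ^ 2), w i‖ + 2 * l) := by gcongr
    _ = ((l : ℝ) ^ 2)⁻¹ * ‖∑ i ∈ Finset.range (l ^ 2), w i‖ + 2 * (l : ℝ)⁻¹ := by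
      field_simp

section RandomWalk
variable {Ω : Type*} [MeasurableSpace Ω] {P : Measure Ω} {X : ℕ → Ω → Circle}

/-- A circle-valued random variable without atoms has no unimodular moment of positive order. -/
theorem norm_integral_circle_pow_lt_one [IsProbabilityMeasure P] {Y : Ω → Circle}
    (hY : AEMeasurable Y P) (hat : ∀ z : Circle, P.map Y {z} = 0) {k : ℕ} (hk : 1 ≤ k) :
    ‖∫ ω, (Y ω : ℂ) ^ k ∂P‖ < 1 := by
  have h1 : ∀ ω, ‖(Y ω : ℂ) ^ k‖ = 1 := fun ω => by rw [norm_pow, Circle.norm_coe, one_pow]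
  rcases ae_eq_const_or_norm_integral_lt_of_norm_le_const (μ := P)
    (Eventually.of_forall fun ω => (h1 ω).le) with hconst | hlt
  -- otherwise `Y ^ k` is almost surely constant, which confines `Y` to finitely many points
  · exfalso
    set a : ℂ := ⨍ ω, (Y ω : ℂ) ^ k ∂P
    have hfin : {z : Circle | (z : ℂ) ^ k = a}.Finite := by
      have hroots : {x : ℂ | x ^ k = a}.Finite := by
        refine (Polynomial.nthRoots k a).toFinset.finite_toSet.subset fun x hx => ?_
        simpa [Polynomial.mem_nthRoots (by omega : 0 < k)] using hx
      exact hroots.preimage Circle.coe_injective.injOn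
    have hnull : P.map Y {z : Circle | (z : ℂ) ^ k = a} = 0 := by
      rw [← Set.biUnion_of_singleton {z : Circle | (z : ℂ) ^ k = a},
        measure_biUnion_null_iff hfin.countable]
      exact fun z _ => hat z
    have hae : ∀ᵐ ω ∂P, Y ω ∉ {z : Circle | (z : ℂ) ^ k = a} := by
      have := ae_of_ae_map hY (measure_eq_zero_iff_ae_notMem.1 hnull)
      exact this
    obtain ⟨ω, h2, h3⟩ := (hae.and hconst).exists
    exact h2 h3
  · simpa using hlt

theorem aemeasurable_circle_prod (hX : ∀ i, AEMeasurable (X i) P) (n : ℕ) :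
    AEMeasurable (fun ω => ∏ i ∈ Finset.range n, X i ω) P :=
  Finset.aemeasurable_fun_prod _ fun i _ => hX i

theorem integral_walk_pow_mul_inv_pow (hX : ∀ i, AEMeasurable (X i) P) (hind : iIndepFun X P)
    {k : ℕ} {χ : ℂ} (hχ : ∀ i, ∫ ω, (X i ω : ℂ) ^ k ∂P = χ) {m n : ℕ} (hmn : m ≤ n) :
    ∫ ω, ((∏ i ∈ Finset.range n, X i ω : Circle) : ℂ) ^ k *
      (((∏ i ∈ Finset.range m, X i ω : Circle) : ℂ)⁻¹) ^ k ∂P = χ ^ (n - m) := by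
  have hpt : ∀ ω, ((∏ i ∈ Finset.range n, X i ω : Circle) : ℂ) ^ k *
      (((∏ i ∈ Finset.range m, X i ω : Circle) : ℂ)⁻¹) ^ k =
      ∏ i : Finset.Ico m n, (X i ω : ℂ) ^ k := by
    intro ω
    rw [Finset.prod_coe_sort (Finset.Ico m n) fun i => (X i ω : ℂ) ^ k, ← mul_pow,
      ← Finset.prod_range_mul_prod_Ico _ hmn, Circle.coe_mul, mul_right_comm,
      mul_inv_cancel₀ (Circle.coe_ne_zero _), one_mul, Finset.prod_pow]
    congr 1
    exact map_prod Circle.coeHom _ _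
  simp_rw [hpt]
  have hind' : iIndepFun (fun i : Finset.Ico m n => X i) P :=
    hind.precomp Subtype.val_injective
  have h := hind'.integral_fun_prod_comp (f := fun (_ : Finset.Ico m n) (z : Circle) => (z : ℂ) ^ k)
    (fun i => hX i) fun i => (continuous_circle_coe.pow k).aestronglyMeasurable
  rw [h]
  simp [hχ]

/-- The strong law of large numbers for the characters of a random walk on the circle: the second
moments of the averages are `O(1 / N)`, which is summable along the squares. -/
theorem ae_tendsto_average_walk_pow [IsProbabilityMeasure P] (hX : ∀ i, AEMeasurable (X i) P)
    (hind : iIndepFun X P) {k : ℕ} {χ : ℂ} (hχ : ∀ i, ∫ ω, (X i ω : ℂ) ^ k ∂P = χ) (hχ1 : ‖χ‖ < 1) :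
    ∀ᵐ ω ∂P, Tendsto (fun N : ℕ => (N : ℂ)⁻¹ * ∑ n ∈ Finset.range N,
      ((∏ i ∈ Finset.range (n + 1), X i ω : Circle) : ℂ) ^ k) atTop (𝓝 0) := by
  set R : ℕ → Ω → Circle := fun n ω => ∏ i ∈ Finset.range (n + 1), X i ω with hR
  have hRm : ∀ n, AEMeasurable (R n) P := fun n => aemeasurable_circle_prod hX (n + 1)
  set K : ℝ := 1 + 2 * (1 * (1 - ‖χ‖)⁻¹) with hK
  set A : ℕ → Ω → ℂ := fun N ω => (N : ℂ)⁻¹ * ∑ n ∈ Finset.range N, (R n ω : ℂ) ^ k with hA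
  have hAm : ∀ N, AEStronglyMeasurable (A N) P := fun N =>
    (Finset.aestronglyMeasurable_fun_sum _ fun n _ => (memLp_circle_pow (hRm n) k).1).const_mul _
  have hmom : ∀ N : ℕ, ∫⁻ ω, ‖A N ω‖ₑ ^ 2 ∂P ≤ ENNReal.ofReal (K * (N : ℝ)⁻¹) := by
    intro N
    have hb := norm_sum_sq_le_of_inner_le_geometric (y := fun n => circlePowL2 (hRm n) k) (C := 1)
      (norm_nonneg χ) hχ1 (fun m n hmn => by
        rw [inner_circlePowL2, integral_walk_pow_mul_inv_pow hX hind hχ (Nat.succ_le_succ hmn),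
          norm_pow, one_mul, Nat.succ_sub_succ]) N
    have h1 : ∫⁻ ω, ‖A N ω‖ₑ ^ 2 ∂P = eLpNorm (A N) 2 P ^ 2 := by
      have := eLpNorm_nnreal_pow_eq_lintegral (f := A N) (μ := P) (p := 2) two_ne_zero
      simpa using this.symm
    rw [h1, hA, ← enorm_smul_sum_circlePowL2 hRm, ← ofReal_norm,
      ← ENNReal.ofReal_pow (norm_nonneg _)]
    refine ENNReal.ofReal_le_ofReal ?_
    rw [norm_smul, norm_inv, RCLike.norm_natCast, mul_pow]
    rcases N.eq_zero_or_pos with rfl | hN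
    · simp
    · have hN' : (0 : ℝ) < N := by exact_mod_cast hN
      calc _ ≤ ((N : ℝ)⁻¹) ^ 2 * (N * K) := by gcongr
        _ = K * (N : ℝ)⁻¹ := by field_simp
  have hsum : ∫⁻ ω, ∑' l : ℕ, ‖A (l ^ 2) ω‖ₑ ^ 2 ∂P ≠ ⊤ := by
    rw [lintegral_tsum fun l => (hAm (l ^ 2)).enorm.pow_const 2]
    have hs : Summable fun l : ℕ => K * (((l ^ 2 : ℕ) : ℝ))⁻¹ := by
      have := (Real.summable_nat_pow_inv (p := 2)).2 one_lt_two
      push_cast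
      exact this.mul_left K
    have hK0 : 0 ≤ K := by
      have : 0 ≤ (1 - ‖χ‖)⁻¹ := inv_nonneg.2 (by linarith)
      rw [hK]; linarith
    refine ne_top_of_le_ne_top ?_ (ENNReal.tsum_le_tsum fun l => hmom (l ^ 2))
    rw [← ENNReal.ofReal_tsum_of_nonneg (fun l => by positivity) hs]
    exact ENNReal.ofReal_ne_top
  have hmeas : AEMeasurable (fun ω => ∑' l : ℕ, ‖A (l ^ 2) ω‖ₑ ^ 2) P :=
    AEMeasurable.tsum fun l => (hAm (l ^ 2)).enorm.pow_const 2
  filter_upwards [ae_lt_top' hmeas hsum] with ω hω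
  refine tendsto_average_of_tendsto_average_sq (w := fun n => (R n ω : ℂ) ^ k)
    (fun n => by rw [norm_pow, Circle.norm_coe, one_pow]) ?_
  have h2 := ENNReal.tendsto_atTop_zero_of_tsum_ne_top hω.ne
  have h3 : Tendsto (fun l : ℕ => ‖A (l ^ 2) ω‖ ^ 2) atTop (𝓝 0) := by
    refine ((ENNReal.tendsto_toReal ENNReal.zero_ne_top).comp h2).congr fun l => ?_
    simp only [Function.comp, ENNReal.toReal_pow, toReal_enorm]
  have h4 := h3.sqrt
  simp only [Real.sqrt_sq (norm_nonneg _), Real.sqrt_zero] at h4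
  exact tendsto_zero_iff_norm_tendsto_zero.2 h4

end RandomWalk

/-! ### Ergodicity for random arguments -/

section compSeq
variable {g : ℕ → ℂ → ℂ}

theorem one_sub_sum_le_norm_prod_pow (hg : ∀ n, 1 ≤ n → IsInnerFunction (g n) ∧ g n 0 = 0) (k : ℕ)
    {m n : ℕ} (hmn : m ≤ n) :
    1 - k * (∑ i ∈ Finset.range n, (1 - ‖deriv (g (i + 1)) 0‖) -
        ∑ i ∈ Finset.range m, (1 - ‖deriv (g (i + 1)) 0‖)) ≤
      ‖∏ j ∈ Finset.Ioc m n, deriv (g j) 0‖ ^ k := by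
  have h1 : 1 - (∑ i ∈ Finset.range n, (1 - ‖deriv (g (i + 1)) 0‖) -
      ∑ i ∈ Finset.range m, (1 - ‖deriv (g (i + 1)) 0‖)) ≤
      ‖∏ j ∈ Finset.Ioc m n, deriv (g j) 0‖ := by
    induction n, hmn using Nat.le_induction with
    | base => simp
    | succ n hmn ih =>
      rw [Finset.prod_Ioc_succ_top (by omega), norm_mul, Finset.sum_range_succ]
      have h2 := norm_prod_deriv_le_one hg m n
      have h3 := norm_deriv_le_one hg (Nat.le_add_left 1 n)
      nlinarith [mul_nonneg (sub_nonneg.2 h2) (sub_nonneg.2 h3)]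
  set p := ‖∏ j ∈ Finset.Ioc m n, deriv (g j) 0‖ with hp
  have h2 := one_add_mul_le_pow (a := p - 1)
    (by linarith [norm_nonneg (∏ j ∈ Finset.Ioc m n, deriv (g j) 0)]) k
  rw [add_sub_cancel] at h2
  have hk : (0 : ℝ) ≤ k := Nat.cast_nonneg k
  nlinarith

/-- After the arguments of the derivatives are divided out, the powers of the boundary maps converge
in `L²`; so ergodicity reduces to that of the rotations by the products of the arguments. -/
theorem isErgodicSeq_of_tendsto_average_prod
    (hg : ∀ n, 1 ≤ n → IsInnerFunction (g n) ∧ g n 0 = 0)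
    (h : Summable fun n : ℕ => 1 - ‖deriv (g (n + 1)) 0‖) {Θ : ℕ → Circle}
    (hΘ : ∀ n, 1 ≤ n → deriv (g n) 0 = (‖deriv (g n) 0‖ : ℂ) * (Θ n : ℂ))
    (hav : ∀ k : ℕ, 1 ≤ k → Tendsto (fun N : ℕ => (N : ℂ)⁻¹ * ∑ n ∈ Finset.range N,
      ((∏ i ∈ Finset.range (n + 1), Θ (i + 1) : Circle) : ℂ) ^ k) atTop (𝓝 0)) :
    IsErgodicSeq circleMeasure (fun n => boundaryMap (compSeq g n)) := by
  refine isErgodicSeq_boundaryMap_compSeq hg id fun k hk => ?_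
  set R : ℕ → Circle := fun n => ∏ i ∈ Finset.range (n + 1), Θ (i + 1) with hR
  set w : ℕ → ℂ := fun n => (R n : ℂ) ^ k with hw
  have hw1 : ∀ n, ‖w n‖ = 1 := fun n => by rw [hw, norm_pow, Circle.norm_coe, one_pow]
  have hw0 : ∀ n, w n ≠ 0 := fun n => norm_ne_zero_iff.1 (by rw [hw1]; exact one_ne_zero)
  set S : ℕ → ℝ := fun n => ∑ i ∈ Finset.range n, (1 - ‖deriv (g (i + 1)) 0‖) with hS
  set z : ℕ → Lp ℂ 2 circleMeasure := fun n => (w n)⁻¹ • boundaryPow hg k (n + 1) with hz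
  have hz1 : ∀ n, ‖z n‖ = 1 := fun n => by
    rw [hz, norm_smul, norm_inv, hw1, norm_boundaryPow, inv_one, one_mul]
  have hprod : ∀ m n, m ≤ n → ∏ j ∈ Finset.Ioc (m + 1) (n + 1), deriv (g j) 0 =
      (‖∏ j ∈ Finset.Ioc (m + 1) (n + 1), deriv (g j) 0‖ : ℂ) * ((R m : ℂ)⁻¹ * R n) := by
    intro m n hmn
    induction n, hmn using Nat.le_induction with
    | base => simp
    | succ n hmn ih =>
      rw [Finset.prod_Ioc_succ_top (by omega), norm_mul, ih, hΘ (n + 1 + 1) (by omega)]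
      have : R (n + 1) = R n * Θ (n + 1 + 1) := Finset.prod_range_succ _ _
      rw [this]
      have hnn : ∀ r : ℝ, 0 ≤ r → ∀ c : Circle, ‖(r : ℂ) * (c : ℂ)‖ = r := fun r hr c => by
        rw [norm_mul, Complex.norm_real, Real.norm_of_nonneg hr, Circle.norm_coe, mul_one]
      have e1 : ((R m : ℂ)⁻¹ * R n) = (((R m)⁻¹ * R n : Circle) : ℂ) := by simp
      rw [e1, hnn _ (norm_nonneg _), hnn _ (norm_nonneg _)]
      push_cast
      ring
  -- `z m` and `z n` are unit vectors with real inner product `∏ |(g j)' 0| ^ k`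
  have hdist : ∀ m n, m ≤ n → dist (z n) (z m) ^ 2 ≤ 2 * k * (S (n + 1) - S (m + 1)) := by
    intro m n hmn
    have hin : inner ℂ (z m) (z n) =
        ((‖∏ j ∈ Finset.Ioc (m + 1) (n + 1), deriv (g j) 0‖ ^ k : ℝ) : ℂ) := by
      rw [hz, inner_smul_left, inner_smul_right, inner_boundaryPow hg k (Nat.succ_le_succ hmn),
        hprod m n hmn, hw]
      simp only [map_inv₀, map_pow, ← Circle.coe_inv_eq_conj, Circle.coe_inv, inv_inv, mul_pow,
        inv_pow]
      have h1 : (R m : ℂ) ^ k ≠ 0 := hw0 m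
      have h2 : (R n : ℂ) ^ k ≠ 0 := hw0 n
      have h3 := hprod m n hmn
      rw [← h3]
      push_cast
      field_simp
    have hlow := one_sub_sum_le_norm_prod_pow hg k (Nat.succ_le_succ hmn)
    rw [dist_comm, dist_eq_norm, norm_sub_sq (𝕜 := ℂ), hin, hz1, hz1]
    simp only [RCLike.re_to_complex, Complex.ofReal_re]
    linarith
  have hSc : CauchySeq fun n => S (n + 1) :=
    ((tendsto_add_atTop_iff_nat 1).2 h.hasSum.tendsto_sum_nat).cauchySeq
  have hzc : CauchySeq z := by
    refine Metric.cauchySeq_iff'.2 fun ε hε => ?_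
    obtain ⟨N, hN⟩ := Metric.cauchySeq_iff'.1 hSc (ε ^ 2 / (2 * k + 1)) (by positivity)
    refine ⟨N, fun n hn => ?_⟩
    have h1 := hdist N n hn
    have h2 := hN n hn
    rw [Real.dist_eq, lt_div_iff₀ (by positivity)] at h2
    have h3 := le_abs_self (S (n + 1) - S (N + 1))
    have h4 := abs_nonneg (S (n + 1) - S (N + 1))
    have hk0 : (0 : ℝ) ≤ k := Nat.cast_nonneg k
    refine lt_of_pow_lt_pow_left₀ 2 hε.le ?_
    nlinarith [mul_le_mul_of_nonneg_left h3 hk0]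
  obtain ⟨l, hl⟩ := cauchySeq_tendsto_of_complete hzc
  have hfin := tendsto_average_smul_of_tendsto (fun n => (hw1 n).le) (hav k hk) hl
  refine hfin.congr fun N => ?_
  congr 1
  refine Finset.sum_congr rfl fun i _ => ?_
  rw [hz, smul_smul, mul_inv_cancel₀ (hw0 i), one_smul]
  rfl

end compSeq

theorem ae_isErgodicSeq_of_iIndepFun {Ω : Type*} [MeasurableSpace Ω] {P : Measure Ω}
    [IsProbabilityMeasure P] {g : Ω → ℕ → ℂ → ℂ} {Θ : ℕ → Ω → Circle}
    (hg : ∀ ω n, 1 ≤ n → IsInnerFunction (g ω n) ∧ g ω n 0 = 0)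
    (hsum : ∀ᵐ ω ∂P, Summable fun n : ℕ => 1 - ‖deriv (g ω (n + 1)) 0‖)
    (hΘ : ∀ n, 1 ≤ n → ∀ᵐ ω ∂P, deriv (g ω n) 0 = (‖deriv (g ω n) 0‖ : ℂ) * (Θ n ω : ℂ))
    (hind : iIndepFun (fun n : ℕ => Θ (n + 1)) P)
    (hid : ∀ n, 1 ≤ n → IdentDistrib (Θ n) (Θ 1) P P) (hat : ∀ z : Circle, P.map (Θ 1) {z} = 0) :
    ∀ᵐ ω ∂P, IsErgodicSeq circleMeasure (fun n => boundaryMap (compSeq (g ω) n)) := by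
  have hm : ∀ i, AEMeasurable (Θ (i + 1)) P := fun i => (hid (i + 1) (by omega)).aemeasurable_fst
  have hχ : ∀ k i : ℕ, ∫ ω, (Θ (i + 1) ω : ℂ) ^ k ∂P = ∫ ω, (Θ 1 ω : ℂ) ^ k ∂P := fun k i =>
    ((hid (i + 1) (by omega)).comp (continuous_circle_coe.pow k).measurable).integral_eq
  have hav : ∀ᵐ ω ∂P, ∀ k : ℕ, 1 ≤ k → Tendsto (fun N : ℕ => (N : ℂ)⁻¹ * ∑ n ∈ Finset.range N,
      ((∏ i ∈ Finset.range (n + 1), Θ (i + 1) ω : Circle) : ℂ) ^ k) atTop (𝓝 0) := by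
    refine ae_all_iff.2 fun k => ?_
    by_cases hk : 1 ≤ k
    · filter_upwards [ae_tendsto_average_walk_pow hm hind (hχ k)
        (norm_integral_circle_pow_lt_one (hm 0) hat hk)] with ω hω _ using hω
    · exact Eventually.of_forall fun ω h => absurd h hk
  have hΘ' : ∀ᵐ ω ∂P, ∀ n, 1 ≤ n →
      deriv (g ω n) 0 = (‖deriv (g ω n) 0‖ : ℂ) * (Θ n ω : ℂ) := by
    refine ae_all_iff.2 fun n => ?_
    by_cases hn : 1 ≤ n
    · filter_upwards [hΘ n hn] with ω hω _ using hω
    · exact Eventually.of_forall fun ω h => absurd h hn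
  filter_upwards [hsum, hav, hΘ'] with ω h1 h2 h3
  exact isErgodicSeq_of_tendsto_average_prod (hg ω) h1 h3 h2

theorem mainTheorem9 :
    -- deterministic sequences of inner functions `g 1, g 2, …` fixing the origin
    (∀ g : ℕ → ℂ → ℂ, (∀ n, 1 ≤ n → IsInnerFunction (g n) ∧ g n 0 = 0) →
      -- (i)
      ((¬ Summable fun n : ℕ => 1 - ‖deriv (g (n + 1)) 0‖) →
        ∃ s : ℕ → ℕ, StrictMono s ∧
          IsMixingSeq circleMeasure (fun k => boundaryMap (compSeq g (s k)))) ∧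
      -- (ii)
      ((∃ lam c M₀ : ℝ, 0 < lam ∧ lam < 1 ∧ 0 < c ∧ c < 1 ∧ 0 < M₀ ∧
          ∀ a b : ℕ, 1 ≤ a → M₀ < (b : ℝ) - (a : ℝ) →
            c * ((b : ℝ) - (a : ℝ)) ≤
              (({n : ℕ | n ∈ Set.Icc a b ∧ ‖deriv (g n) 0‖ ≤ lam}.ncard : ℕ) : ℝ)) →
        IsMixingSeq circleMeasure (fun n => boundaryMap (compSeq g n))) ∧
      -- (iii)(a), with angles taken modulo `2π`
      ((Summable fun n : ℕ => 1 - ‖deriv (g (n + 1)) 0‖) →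
        ∀ θ : ℝ, Irrational θ →
          Tendsto (fun n : ℕ => ((Complex.arg (deriv (g n) 0) : ℝ) : Real.Angle)) atTop
            (𝓝 ((2 * Real.pi * θ : ℝ) : Real.Angle)) →
          IsErgodicSeq circleMeasure (fun n => boundaryMap (compSeq g n)))) ∧
    -- (iii)(b): random sequences; `Θ n` is the point `e ^ (i arg)` of the circle for `(g n)' 0`
    (∀ (Ω : Type*) [MeasurableSpace Ω] (P : Measure Ω) [IsProbabilityMeasure P]
      (g : Ω → ℕ → ℂ → ℂ) (Θ : ℕ → Ω → Circle),
      (∀ ω n, 1 ≤ n → IsInnerFunction (g ω n) ∧ g ω n 0 = 0) →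
      (∀ᵐ ω ∂P, Summable fun n : ℕ => 1 - ‖deriv (g ω (n + 1)) 0‖) →
      (∀ n, 1 ≤ n → ∀ᵐ ω ∂P, deriv (g ω n) 0 = (‖deriv (g ω n) 0‖ : ℂ) * (Θ n ω : ℂ)) →
      iIndepFun (fun n : ℕ => Θ (n + 1)) P →
      (∀ n, 1 ≤ n → IdentDistrib (Θ n) (Θ 1) P P) →
      (∀ z : Circle, P.map (Θ 1) {z} = 0) →
      ∀ᵐ ω ∂P, IsErgodicSeq circleMeasure (fun n => boundaryMap (compSeq (g ω) n))) := by
  refine ⟨fun g hg => ⟨exists_isMixingSeq_of_not_summable hg, ?_, ?_⟩, ?_⟩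
  · rintro ⟨lam, c, M₀, hl0, hl1, hc0, -, -, h⟩
    exact isMixingSeq_of_density hg hl0 hl1 hc0 h
  · exact fun hsum θ hθ harg => isErgodicSeq_of_tendsto_arg hg hsum hθ harg
  · intro Ω _ P _ g Θ hg hsum hΘ hind hid hat
    exact ae_isErgodicSeq_of_iIndepFun hg hsum hΘ hind hid hat
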